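/- Let $n\ge 2$ and $m\ge 1$ be integers, and let $\Omega\subset\mathbb R^n$ be open, bounded and connected, with $0\in\Omega$, such that - $\Omega$ is convex in the $x_1$-direction: if $p,q\in\Omega$ and $p_j=q_j$ for all $j\in\{2,\dots,n\}$, then $(1-t)p+tq\in\Omega$ for all $t\in[0,1]$; - $\Omega$ is symmetric with respect to $\{x_1=0\}$: if $(p_1,p_2,\dots,p_n)\in\Omega$ then $(-p_1,p_2,\dots,p_n)\in\Omega$. Let $f:[0,\infty)\to\mathbb R$ be (globally) Lipschitz continuous and non-decreasing, with $f(0)\ge 0$. Let $u\in C^{2m}(\Omega\setminus\{0\})\cap C^{2m-2}(\overline\Omega\setminus\{0\})$ (the second condition meaning that all derivatives of $u$ of order at most $2m-2$ extend continuously from $\Omega\setminus\{0\}$ to $\overline\Omega\setminus\{0\}$) be a classical solution of $$ \begin{cases} (-\Delta)^m u=f(u) & \text{in }\Omega\setminus\{0\},\\ u>0 & \text{in }\Omega\setminus\{0\},\\ u=-\Delta u=\dots=(-\Delta)^{m-1}u=0 & \text{on }\partial\Omega,\\ \inf_{\Omega\setminus\{0\}}(-\Delta)^j u>-\infty & \text{for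 } j=1,\dots,m-1. \end{cases} $$ Then: 1. $u$ is symmetric in $x_1$: $u(-x_1,x_2,\dots,x_n)=u(x_1,x_2,\dots,x_n)$ for every $x\in\Omega\setminus\{0\}$; 2. $u$ is strictly decreasing with respect to $x_1$ on $\Omega\cap\{x_1>0\}$: if $x,y\in\Omega$ satisfy $x_j=y_j$ for all $j\in\{2,\dots,n\}$ and $0<x_1<y_1$, then $u(y)<u(x)$. In particular, if $\Omega=\{x\in\mathbb R^n:|x|<R\}$ for some $R>0$, then $u$ is radial and strictly radially decreasing: there is a function $\varphi$, strictly decreasing on $(0,R)$, with $u(x)=\varphi(|x|)$ for all $x\in\Omega\setminus\{0\}$. -/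

import Mathlib

open Set Filter Topology
open scoped NNReal

/-- The operator `-Δ` on real functions on `ℝⁿ`, where `Δ` is Mathlib's Laplacian. The value at a
point only depends on the function near that point. The power `(-Δ)^j` is `negLaplacian^[j]`. -/
noncomputable def negLaplacian {n : ℕ} (v : EuclideanSpace ℝ (Fin n) → ℝ) :
    EuclideanSpace ℝ (Fin n) → ℝ :=
  fun x => -(Laplacian.laplacian v x)

/-- The reflection of `ℝⁿ` that changes the sign of the `i`-th coordinate. -/
noncomputable def coordReflection {n : ℕ} (i : Fin n) (x : EuclideanSpace ℝ (Fin n)) :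
    EuclideanSpace ℝ (Fin n) :=
  WithLp.toLp 2 (fun j => if j = i then -(x j) else x j)

/-- A domain (open, bounded, connected) that contains `0`, is convex in the direction of the `i`-th
coordinate, and is symmetric with respect to the hyperplane `x_i = 0`. -/
structure IsSymmetricConvexDomain {n : ℕ} (i : Fin n) (Ω : Set (EuclideanSpace ℝ (Fin n))) :
    Prop where
  isOpen : IsOpen Ω
  isBounded : Bornology.IsBounded Ω
  isConnected : IsConnected Ω
  convex_dir : ∀ p ∈ Ω, ∀ q ∈ Ω, (∀ j, j ≠ i → p j = q j) →
    ∀ t ∈ Icc (0 : ℝ) 1, (1 - t) • p + t • q ∈ Ω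
  reflection_mem : ∀ p ∈ Ω, coordReflection i p ∈ Ω
  zero_mem : (0 : EuclideanSpace ℝ (Fin n)) ∈ Ω

/-- The condition on the nonlinearity `f : [0, ∞) → ℝ` (only the values on `[0, ∞)` matter):
globally Lipschitz, `f 0 ≥ 0`, and non-decreasing. -/
structure IsAdmissibleNonlinearity (f : ℝ → ℝ) : Prop where
  lipschitz : ∃ K : ℝ≥0, LipschitzOnWith K f (Ici 0)
  zero_nonneg : 0 ≤ f 0
  monotone : MonotoneOn f (Ici 0)

/-- The class `C^k(S)` for an open set `U` with `U ⊆ S ⊆ closure U`: the function is of class `C^k`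
in `U`, and all its derivatives of order at most `k` extend continuously from `U` to `S`. -/
def ContDiffUpTo {n : ℕ} (k : ℕ) (v : EuclideanSpace ℝ (Fin n) → ℝ)
    (U S : Set (EuclideanSpace ℝ (Fin n))) : Prop :=
  ContDiffOn ℝ k v U ∧
    ∀ j ≤ k, ∃ g : EuclideanSpace ℝ (Fin n) →
        ContinuousMultilinearMap ℝ (fun _ : Fin j => EuclideanSpace ℝ (Fin n)) ℝ,
      ContinuousOn g S ∧ EqOn g (iteratedFDeriv ℝ j v) U

/-- `u` is a positive classical solution of `(-Δ)^m u = f(u)` in `Ω ∖ {0}` with Navier conditions on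
the boundary of `Ω` and with `(-Δ)^j u` bounded below for `1 ≤ j ≤ m - 1`. Only the values of `u`
on `Ω ∖ {0}` matter. -/
structure IsPositiveNavierSolution {n : ℕ} (m : ℕ) (Ω : Set (EuclideanSpace ℝ (Fin n)))
    (f : ℝ → ℝ) (u : EuclideanSpace ℝ (Fin n) → ℝ) : Prop where
  contDiffOn : ContDiffOn ℝ ((2 * m : ℕ) : WithTop ℕ∞) u (Ω \ {0})
  contDiffUpTo : ContDiffUpTo (2 * m - 2) u (Ω \ {0}) (closure Ω \ {0})
  equation : ∀ x ∈ Ω \ {0}, negLaplacian^[m] u x = f (u x)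
  pos : ∀ x ∈ Ω \ {0}, 0 < u x
  /-- The continuous extension of `(-Δ)^j u` to the boundary vanishes, for `0 ≤ j ≤ m - 1`. -/
  navier : ∀ j < m, ∀ y ∈ frontier Ω, Tendsto (negLaplacian^[j] u) (𝓝[Ω \ {0}] y) (𝓝 0)
  bddBelow : ∀ j, 1 ≤ j → j < m → BddBelow (negLaplacian^[j] u '' (Ω \ {0}))

/-! ### Second-order calculus: minima, radial functions and isometries under the Laplacian. -/

section Calculus

variable {E : Type*} [NormedAddCommGroup E] [InnerProductSpace ℝ E]

open Laplacian

/-! The proof is the method of moving planes for a cooperative system. With `k = m - 1`, the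
functions `V j = (-Δ)^j u`, extended by zero, satisfy `-Δ V j = V (j+1)` for `j < k` and `-Δ V k = f
(V 0)`. In dimension at least 2 a point has zero capacity: a superharmonic function bounded below
near an isolated singularity still obeys the maximum principle (`nonneg_of_superharmonic`). Since `f
u ≥ 0`, descending through the system gives `V j ≥ 0`.

On the cap beyond the hyperplane `⟪e, x⟫ = l`, `l > 0`, let `w_j` be the difference between the
reflected `V j` and `V j`. Its only singularity is the reflected origin, where it is bounded below
because `V j ≥ 0`. It is nonnegative on the boundary of the cap. As `f` is non-decreasing, `w_0 ≥ 0`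
makes `w_k` superharmonic, hence nonnegative, and then every `w_j` in turn.

The set of `l > 0` with `w_0 ≥ 0` contains all large `l` (empty cap) and is relatively closed. It is
also open (`eventually_planeDiff_nonneg`): the strong maximum principle gives `w_0 > 0` on the cap
(`planeDiff_pos`), so for nearby `l` negative values occur only on a set of small measure. Such a
set carries a uniformly small potential `φ` with `Δ φ ≤ -1` on it (`exists_small_potential`).
Corrected by `φ`, a lower bound `-M` for `w_0` improves to `-M/2`; iteration gives `w_0 ≥ 0`. The
Lipschitz bound on `f` enters only here.

Thus `w_0 > 0` for all `l > 0`, which is strict monotonicity. Letting `l` tend to 0, for `e` and for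
`-e`, gives symmetry. On a ball every direction `e` is admissible, whence radial symmetry. -/

theorem IsLocalMin.fderiv_fderiv_nonneg {f : E → ℝ} {x : E} (hf : ContDiffAt ℝ 2 f x)
    (hm : IsLocalMin f x) (v : E) : 0 ≤ fderiv ℝ (fderiv ℝ f) x v v := by
  by_contra! hneg
  let l : ℝ → E := fun t => x + t • v
  have hl : ∀ t, HasDerivAt l v t := fun t => by
    simpa [l] using ((hasDerivAt_id t).smul_const v).const_add x
  have hl0 : l 0 = x := by simp [l]
  have hlc : Tendsto l (𝓝 0) (𝓝 x) := by simpa [hl0] using (hl 0).continuousAt.tendsto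
  have hd : ∀ᶠ y in 𝓝 x, DifferentiableAt ℝ f y :=
    (hf.eventually (by simp)).mono fun y hy => hy.differentiableAt (by norm_num)
  have h1 : deriv (f ∘ l) =ᶠ[𝓝 0] fun t => fderiv ℝ f (l t) v := by
    filter_upwards [hlc.eventually hd] with t ht
    exact (ht.hasFDerivAt.comp_hasDerivAt t (hl t)).deriv
  have hdd : DifferentiableAt ℝ (fderiv ℝ f) (l 0) := by
    rw [hl0]
    exact (hf.fderiv_right (m := 1) (by norm_num)).differentiableAt (by norm_num)
  have h2 : deriv (deriv (f ∘ l)) 0 = fderiv ℝ (fderiv ℝ f) x v v := by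
    rw [h1.deriv_eq]
    have := (hdd.hasFDerivAt.comp_hasDerivAt 0 (hl 0)).clm_apply (hasDerivAt_const (0 : ℝ) v)
    simpa [hl0] using this.deriv
  have hmin : IsLocalMin (f ∘ l) 0 := by
    have := hlc.eventually hm
    simpa [IsLocalMin, IsMinFilter, hl0] using this
  -- A negative second derivative along the line would make `0` a local maximum as well, so `f ∘ l`
  -- would be locally constant, with zero second derivative.
  have hmax : IsLocalMax (f ∘ l) 0 := by
    refine isLocalMax_of_deriv_deriv_neg (h2 ▸ hneg) hmin.deriv_eq_zero ?_
    exact ContinuousAt.comp (by rw [hl0]; exact hf.continuousAt) (hl 0).continuousAt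
  have hconst : f ∘ l =ᶠ[𝓝 0] fun _ => (f ∘ l) 0 := by
    filter_upwards [hmin, hmax] with t h h' using le_antisymm h' h
  have : deriv (deriv (f ∘ l)) 0 = 0 := by
    rw [hconst.deriv.deriv_eq]
    simp
  rw [h2] at this
  exact hneg.ne this

theorem contDiffAt_comp_norm_sq {g : ℝ → ℝ} {c : ℝ} {a x : E}
    (hg : ContDiffAt ℝ 2 g (‖x - a‖ ^ 2 + c)) :
    ContDiffAt ℝ 2 (fun y => g (‖y - a‖ ^ 2 + c)) x := by
  have h : ContDiffAt ℝ 2 (fun y : E => ‖y - a‖ ^ 2 + c) x :=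
    ((contDiff_id.sub contDiff_const).norm_sq ℝ |>.add contDiff_const).contDiffAt
  exact ContDiffAt.comp x hg h

variable [FiniteDimensional ℝ E]

theorem laplacian_eq_sum_fderiv_fderiv {ι : Type*} [Fintype ι] (b : OrthonormalBasis ι ℝ E)
    (f : E → ℝ) (x : E) : Δ f x = ∑ i, fderiv ℝ (fderiv ℝ f) x (b i) (b i) := by
  rw [InnerProductSpace.laplacian_eq_iteratedFDeriv_orthonormalBasis f b]
  simp [iteratedFDeriv_two_apply]

/-- The Laplacian of a function of `‖x - a‖ ^ 2`. -/
theorem laplacian_comp_norm_sq {g g₁ : ℝ → ℝ} {g₂ c : ℝ} {a x : E}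
    (hg : ∀ᶠ t in 𝓝 (‖x - a‖ ^ 2 + c), HasDerivAt g (g₁ t) t)
    (hg₁ : HasDerivAt g₁ g₂ (‖x - a‖ ^ 2 + c)) :
    Δ (fun y => g (‖y - a‖ ^ 2 + c)) x
      = 4 * g₂ * ‖x - a‖ ^ 2 + 2 * Module.finrank ℝ E * g₁ (‖x - a‖ ^ 2 + c) := by
  obtain ⟨B, hB⟩ : ∃ B : E →L[ℝ] E →L[ℝ] ℝ, ∀ v w, B v w = inner ℝ v w :=
    ⟨innerSL ℝ, fun _ _ => rfl⟩
  have hN : ∀ y : E, HasFDerivAt (fun y : E => ‖y - a‖ ^ 2 + c) ((2 : ℝ) • B (y - a)) y := by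
    intro y
    have := ((hasFDerivAt_id y).sub_const a).norm_sq.add_const c
    refine this.congr_fderiv ?_
    ext v
    simp [hB, two_mul]
  have hcont : ContinuousAt (fun y : E => ‖y - a‖ ^ 2 + c) x := (hN x).continuousAt
  have h1 : ∀ᶠ y in 𝓝 x, fderiv ℝ (fun y => g (‖y - a‖ ^ 2 + c)) y
      = g₁ (‖y - a‖ ^ 2 + c) • ((2 : ℝ) • B (y - a)) := by
    filter_upwards [hcont.eventually hg] with y hy
    exact (hy.comp_hasFDerivAt y (hN y)).fderiv
  have h2 : HasFDerivAt (fun y : E => (2 : ℝ) • B (y - a)) ((2 : ℝ) • B) x := by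
    exact (B.hasFDerivAt.comp x ((hasFDerivAt_id x).sub_const a)).const_smul
      (2 : ℝ)
  have h3 := ((hg₁.comp_hasFDerivAt x (hN x)).smul h2).fderiv
  rw [laplacian_eq_sum_fderiv_fderiv (stdOrthonormalBasis ℝ E),
    EventuallyEq.fderiv_eq h1]
  refine (congrArg (fun T : E →L[ℝ] E →L[ℝ] ℝ => ∑ i, T (stdOrthonormalBasis ℝ E i)
    (stdOrthonormalBasis ℝ E i)) h3).trans ?_
  have hp := (stdOrthonormalBasis ℝ E).sum_sq_inner_left (x - a)
  have hterm : ∀ i, ((g₁ (‖x - a‖ ^ 2 + c) • (2 : ℝ) • B +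
      (g₂ • (2 : ℝ) • B (x - a)).smulRight ((2 : ℝ) • B (x - a)) :
        E →L[ℝ] E →L[ℝ] ℝ) (stdOrthonormalBasis ℝ E i)) (stdOrthonormalBasis ℝ E i)
      = 2 * g₁ (‖x - a‖ ^ 2 + c) + 4 * g₂ * inner ℝ (x - a) (stdOrthonormalBasis ℝ E i) ^ 2 := by
    intro i
    simp only [add_apply, smul_apply, ContinuousLinearMap.smulRight_apply, smul_eq_mul]
    rw [hB, hB, real_inner_self_eq_norm_sq, OrthonormalBasis.norm_eq_one]
    ring
  refine (Finset.sum_congr rfl fun i _ => hterm i).trans ?_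
  rw [Finset.sum_add_distrib, ← Finset.mul_sum, ← Finset.mul_sum, hp]
  simp
  ring

theorem IsLocalMin.laplacian_nonneg {f : E → ℝ} {x : E} (hf : ContDiffAt ℝ 2 f x)
    (hm : IsLocalMin f x) : 0 ≤ Δ f x := by
  rw [laplacian_eq_sum_fderiv_fderiv (stdOrthonormalBasis ℝ E)]
  exact Finset.sum_nonneg fun i _ => hm.fderiv_fderiv_nonneg hf _

theorem laplacian_add_const_mul {v w : E → ℝ} {x : E} (c : ℝ) (hv : ContDiffAt ℝ 2 v x)
    (hw : ContDiffAt ℝ 2 w x) : Δ (fun y => v y + c * w y) x = Δ v x + c * Δ w x := by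
  have h := hv.laplacian_add (f₂ := c • w) (contDiffAt_const.smul hw)
  rw [InnerProductSpace.laplacian_smul c hw] at h
  exact h

/-- Composition of a function with an affine isometry commutes with the Laplacian. -/
theorem laplacian_comp_affineIsometry (A : E ≃ₗᵢ[ℝ] E) (c : E) {v : E → ℝ} {x : E}
    (hv : ContDiffAt ℝ 2 v (A x + c)) : Δ (fun y => v (A y + c)) x = Δ v (A x + c) := by
  have hA : ∀ y, HasFDerivAt (fun y => A y + c) (A : E →L[ℝ] E) y := fun y =>
    (A.toContinuousLinearEquiv : E →L[ℝ] E).hasFDerivAt.add_const c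
  have hd : ∀ᶠ y in 𝓝 (A x + c), DifferentiableAt ℝ v y :=
    (hv.eventually (by simp)).mono fun y hy => hy.differentiableAt (by norm_num)
  have h1 : fderiv ℝ (fun y => v (A y + c)) =ᶠ[𝓝 x]
      fun y => (fderiv ℝ v (A y + c)).comp (A : E →L[ℝ] E) := by
    filter_upwards [(hA x).continuousAt.eventually hd] with y hy
    exact (hy.hasFDerivAt.comp y (hA y)).fderiv
  have hdd : DifferentiableAt ℝ (fderiv ℝ v) (A x + c) :=
    (hv.fderiv_right (m := 1) (by norm_num)).differentiableAt (by norm_num)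
  have h2 := (hdd.hasFDerivAt.comp x (hA x)).clm_comp (hasFDerivAt_const (A : E →L[ℝ] E) x)
  -- The right-hand Laplacian is computed in the image basis under `A`, so that the two sums agree
  -- term by term.
  rw [laplacian_eq_sum_fderiv_fderiv (stdOrthonormalBasis ℝ E),
    laplacian_eq_sum_fderiv_fderiv ((stdOrthonormalBasis ℝ E).map A), h1.fderiv_eq]
  have h3 := h2.fderiv
  simp only [Function.comp_def] at h3
  rw [h3]
  simp

end Calculus

/-! ### Maximum principles for superharmonic functions, with an isolated singularity. -/

section MaximumPrinciple

variable {E : Type*} [NormedAddCommGroup E] [InnerProductSpace ℝ E] [FiniteDimensional ℝ E]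

open Laplacian

/-- A strictly superharmonic singular barrier: `log (R / ‖x - p‖) + R ^ 2 - ‖x - p‖ ^ 2`. -/
theorem exists_singular_barrier (hd : 2 ≤ Module.finrank ℝ E) (p : E) {R : ℝ} (hR : 0 < R) :
    ∃ H : E → ℝ, (∀ x, x ≠ p → ContDiffAt ℝ 2 H x) ∧ (∀ x, x ≠ p → Δ H x < 0) ∧
      (∀ x, x ≠ p → ‖x - p‖ ≤ R → 0 ≤ H x) ∧
      ∀ M : ℝ, ∃ r > 0, ∀ x, x ≠ p → ‖x - p‖ < r → M < H x := by
  let g : ℝ → ℝ := fun t => (Real.log (R ^ 2) - Real.log t) / 2 + (R ^ 2 - t)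
  have hpos : ∀ x, x ≠ p → 0 < ‖x - p‖ ^ 2 + 0 := fun x hx => by
    have := norm_pos_iff.2 (sub_ne_zero.2 hx)
    positivity
  have hg : ∀ t, 0 < t → HasDerivAt g (-(1 / 2) * t⁻¹ - 1) t := by
    intro t ht
    have := (((Real.hasDerivAt_log ht.ne').const_sub (Real.log (R ^ 2))).div_const 2).add
      ((hasDerivAt_id t).const_sub (R ^ 2))
    refine this.congr_deriv ?_
    ring
  have hg' : ∀ t, 0 < t → HasDerivAt (fun t : ℝ => -(1 / 2) * t⁻¹ - 1)
      (1 / 2 * (t ^ 2)⁻¹) t := by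
    intro t ht
    have := ((hasDerivAt_inv ht.ne').const_mul (-(1 / 2))).sub_const 1
    refine this.congr_deriv ?_
    ring
  refine ⟨fun x => g (‖x - p‖ ^ 2 + 0), fun x hx => ?_, fun x hx => ?_, fun x hx hxR => ?_,
    fun M => ?_⟩
  · refine contDiffAt_comp_norm_sq ?_
    have := hpos x hx
    have hl : ContDiffAt ℝ 2 Real.log (‖x - p‖ ^ 2 + 0) := Real.contDiffAt_log.2 this.ne'
    exact ((contDiffAt_const.sub hl).div_const 2).add (contDiffAt_const.sub contDiffAt_id)
  -- With `t = ‖x - p‖ ^ 2` and `d` the dimension, the Laplacian is `(2 - d) / t - 2 * d`: the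
  -- logarithm contributes a nonpositive term because `d ≥ 2`, and the quadratic term makes the sign
  -- strict.
  · rw [laplacian_comp_norm_sq (g₁ := fun t => -(1 / 2) * t⁻¹ - 1)
      ((lt_mem_nhds (hpos x hx)).mono hg) (hg' _ (hpos x hx))]
    have h := hpos x hx
    rw [add_zero] at h ⊢
    set t := ‖x - p‖ ^ 2
    have h2 : (2 : ℝ) ≤ Module.finrank ℝ E := by exact_mod_cast hd
    have e : 4 * (1 / 2 * (t ^ 2)⁻¹) * t = 2 * t⁻¹ := by field_simp; norm_num
    rw [e]
    have : 0 < t⁻¹ := inv_pos.2 h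
    nlinarith
  · have h := hpos x hx
    rw [add_zero] at h
    have hle : ‖x - p‖ ^ 2 ≤ R ^ 2 := by gcongr
    have := Real.log_le_log h hle
    simp only [g, add_zero]
    linarith
  · have hlog : Tendsto (fun t : ℝ => -Real.log t) (𝓝[>] 0) atTop :=
      tendsto_neg_atBot_atTop.comp Real.tendsto_log_nhdsGT_zero
    obtain ⟨s, hs, hsM⟩ := mem_nhdsGT_iff_exists_Ioo_subset.1
      (hlog.eventually_gt_atTop (M - Real.log R))
    refine ⟨min s R, lt_min hs hR, fun x hx hxr => ?_⟩
    have h0 := norm_pos_iff.2 (sub_ne_zero.2 hx)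
    have h1 : M - Real.log R < -Real.log ‖x - p‖ := hsM ⟨h0, hxr.trans_le (min_le_left _ _)⟩
    have h2 : ‖x - p‖ ^ 2 ≤ R ^ 2 := by
      have := hxr.le.trans (min_le_right _ _)
      gcongr
    simp only [g, add_zero, Real.log_pow]
    push_cast
    linarith

/-- The maximum principle on a bounded open set, with one isolated singularity at which the
superharmonic function is only bounded below. -/
theorem nonneg_of_superharmonic (hd : 2 ≤ Module.finrank ℝ E) {D : Set E} (hD : IsOpen D)
    (hb : Bornology.IsBounded D) (p : E) {w : E → ℝ}
    (hw : ∀ x ∈ D \ {p}, ContDiffAt ℝ 2 w x) (hΔ : ∀ x ∈ D \ {p}, Δ w x ≤ 0)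
    (hbelow : BddBelow (w '' (D \ {p}))) (hcont : ContinuousOn w (closure D \ {p}))
    (hbd : ∀ y ∈ frontier D, y ≠ p → 0 ≤ w y) : ∀ x ∈ D \ {p}, 0 ≤ w x := by
  obtain ⟨R, hR0, hR⟩ : ∃ R > 0, closure D ⊆ Metric.closedBall p R := by
    obtain ⟨R, hR⟩ := hb.subset_closedBall p
    refine ⟨max R 1, by positivity, ?_⟩
    exact closure_minimal (hR.trans (Metric.closedBall_subset_closedBall (le_max_left _ _)))
      Metric.isClosed_closedBall
  obtain ⟨H, hH, hHΔ, hH0, hHp⟩ := exists_singular_barrier hd p hR0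
  obtain ⟨M, hM⟩ := hbelow
  have hM : ∀ x ∈ D \ {p}, M ≤ w x := fun x hx => hM (mem_image_of_mem _ hx)
  have hHcl : ∀ x ∈ closure D, x ≠ p → 0 ≤ H x := fun x hx hxp =>
    hH0 x hxp (by simpa [dist_eq_norm] using hR hx)
  -- The term `η * H` blows up at `p`, so a negative minimum of the sum is attained at an interior
  -- point away from `p`. This contradicts the strict negativity of its Laplacian. Afterwards `η`
  -- tends to 0.
  have key : ∀ η > 0, ∀ x ∈ D \ {p}, 0 ≤ w x + η * H x := by
    intro η hη x₀ hx₀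
    by_contra! hc
    set z : E → ℝ := fun x => w x + η * H x with hz
    obtain ⟨r, hr, hrz⟩ := hHp (-M / η)
    have hzr : ∀ x ∈ D \ {p}, ‖x - p‖ < r → 0 < z x := fun x hx hxr => by
      have h1 := hrz x hx.2 hxr
      rw [div_lt_iff₀ hη] at h1
      have h2 := hM x hx
      simp only [hz]
      linarith
    have hzc : ContinuousOn z (closure D \ {p}) := hcont.add <| continuousOn_const.mul
      fun x hx => (hH x hx.2).continuousAt.continuousWithinAt
    have hsub : closure D \ Metric.ball p r ⊆ closure D \ {p} := fun x hx =>
      ⟨hx.1, fun h => hx.2 (by rw [mem_singleton_iff.1 h]; exact Metric.mem_ball_self hr)⟩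
    have hK : IsCompact (closure D \ Metric.ball p r) :=
      hb.isCompact_closure.diff Metric.isOpen_ball
    have hx₀K : x₀ ∈ closure D \ Metric.ball p r := by
      refine ⟨subset_closure hx₀.1, fun h => ?_⟩
      have := hzr x₀ hx₀ (by simpa [dist_eq_norm] using h)
      linarith
    obtain ⟨x₁, hx₁, hmin⟩ := hK.exists_isMinOn ⟨x₀, hx₀K⟩ (hzc.mono hsub)
    have hx₁c : z x₁ < 0 := (hmin hx₀K).trans_lt hc
    have hx₁p : x₁ ≠ p := (hsub hx₁).2
    have hx₁D : x₁ ∈ D := by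
      by_contra hn
      have h1 := hbd x₁ ⟨hx₁.1, by rwa [hD.interior_eq]⟩ hx₁p
      have h2 := hHcl x₁ hx₁.1 hx₁p
      have : 0 ≤ z x₁ := by positivity
      linarith
    have hloc : IsLocalMin z x₁ := by
      filter_upwards [(hD.sdiff isClosed_singleton).mem_nhds ⟨hx₁D, hx₁p⟩] with x hx
      by_cases hxr : ‖x - p‖ < r
      · exact hx₁c.le.trans (hzr x hx hxr).le
      · exact hmin ⟨subset_closure hx.1, by simpa [dist_eq_norm] using hxr⟩
    have h1 := hw x₁ ⟨hx₁D, hx₁p⟩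
    have h2 := hH x₁ hx₁p
    have h3 := hloc.laplacian_nonneg (h1.add (contDiffAt_const.mul h2))
    rw [laplacian_add_const_mul η h1 h2] at h3
    have h4 := hΔ x₁ ⟨hx₁D, hx₁p⟩
    have h5 := mul_neg_of_pos_of_neg hη (hHΔ x₁ hx₁p)
    linarith
  intro x hx
  have hlim : Tendsto (fun η => w x + η * H x) (𝓝[>] 0) (𝓝 (w x + 0 * H x)) :=
    ((continuous_const.add (continuous_id.mul continuous_const)).tendsto 0).mono_left
      nhdsWithin_le_nhds
  simpa using ge_of_tendsto hlim (eventually_mem_nhdsWithin.mono fun η hη => key η hη x hx)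

/-- Positivity of a nonnegative superharmonic function spreads from the centre of a ball. -/
theorem pos_of_superharmonic_ball (hd : 2 ≤ Module.finrank ℝ E) {U : Set E} {w : E → ℝ}
    (hw : ∀ x ∈ U, ContDiffAt ℝ 2 w x) (hΔ : ∀ x ∈ U, Δ w x ≤ 0) (h0 : ∀ x ∈ U, 0 ≤ w x)
    {a : E} {R : ℝ} (hU : Metric.closedBall a R ⊆ U) (ha : 0 < w a) :
    ∀ x ∈ Metric.ball a R, 0 < w x := by
  intro x hx
  have hR : 0 < R := Metric.pos_of_mem_ball hx
  have hcont : ContinuousAt w a := (hw a (hU (Metric.mem_closedBall_self hR.le))).continuousAt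
  obtain ⟨r, hr, hrw⟩ := Metric.eventually_nhds_iff_ball.1
    (hcont.eventually (lt_mem_nhds (half_lt_self ha)))
  by_cases hxr : x ∈ Metric.ball a r
  · exact (half_pos ha).trans (hrw x hxr)
  set ρ := min r R / 2 with hρ
  have hρ0 : 0 < ρ := by positivity
  have hρr : ρ < r := (half_lt_self (lt_min hr hR)).trans_le (min_le_left _ _)
  have hρR : ρ < R := (half_lt_self (lt_min hr hR)).trans_le (min_le_right _ _)
  set d : ℕ := Module.finrank ℝ E
  -- Hopf's barrier on an annulus, `‖x - a‖^(-2d) - R^(-2d)`. The exponent `2d` exceeds the harmonic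
  -- one `d - 2`, so it is subharmonic away from `a`.
  let g : ℝ → ℝ := fun t => t ^ (-(d : ℤ)) - (R ^ 2) ^ (-(d : ℤ))
  have hg : ∀ t, 0 < t → HasDerivAt g (-(d : ℝ) * t ^ (-(d : ℤ) - 1)) t := by
    intro t ht
    have := (hasDerivAt_zpow (-(d : ℤ)) t (Or.inl ht.ne')).sub_const ((R ^ 2) ^ (-(d : ℤ)))
    simpa [g] using this
  have hg' : ∀ t, 0 < t → HasDerivAt (fun t : ℝ => -(d : ℝ) * t ^ (-(d : ℤ) - 1))
      (-(d : ℝ) * ((-(d : ℝ) - 1) * t ^ (-(d : ℤ) - 1 - 1))) t := by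
    intro t ht
    have := (hasDerivAt_zpow (-(d : ℤ) - 1) t (Or.inl ht.ne')).const_mul (-(d : ℝ))
    simpa using this
  set b : E → ℝ := fun x => g (‖x - a‖ ^ 2 + 0) with hbdef
  have hpos : ∀ y, y ≠ a → 0 < ‖y - a‖ ^ 2 + 0 := fun y hy => by
    have := norm_pos_iff.2 (sub_ne_zero.2 hy)
    positivity
  have hb2 : ∀ y, y ≠ a → ContDiffAt ℝ 2 b y := fun y hy => by
    refine contDiffAt_comp_norm_sq ?_
    have h := (contDiffAt_id (𝕜 := ℝ) (n := 2)).pow d |>.inv (pow_ne_zero d (hpos y hy).ne')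
    simpa [g] using h.sub contDiffAt_const
  have hbΔ : ∀ y, y ≠ a → 0 ≤ Δ b y := fun y hy => by
    have h := hpos y hy
    rw [hbdef, laplacian_comp_norm_sq ((lt_mem_nhds h).mono hg) (hg' _ h)]
    rw [add_zero] at h ⊢
    set t := ‖y - a‖ ^ 2
    have e : t ^ (-(d : ℤ) - 1) = t ^ (-(d : ℤ) - 1 - 1) * t := by
      rw [← zpow_add_one₀ h.ne']
      ring_nf
    rw [e]
    have h1 : 0 < t ^ (-(d : ℤ) - 1 - 1) * t := by positivity
    have h2 : 0 ≤ (d : ℝ) * (2 * d + 4) * (t ^ (-(d : ℤ) - 1 - 1) * t) := by positivity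
    change 0 ≤ 4 * _ * t + 2 * (d : ℝ) * _
    linarith
  -- This makes `δ * b ≤ w a / 2 < w` on the inner sphere; on the outer sphere `b` vanishes.
  set δ : ℝ := (w a / 2) / ((ρ ^ 2) ^ (-(d : ℤ))) with hδ
  have hδ0 : 0 < δ := by positivity
  set D : Set E := Metric.ball a R \ Metric.closedBall a ρ with hDdef
  have hDo : IsOpen D := Metric.isOpen_ball.sdiff Metric.isClosed_closedBall
  have hDb : Bornology.IsBounded D := Metric.isBounded_ball.subset sdiff_subset
  have hcl : closure D ⊆ Metric.closedBall a R \ Metric.ball a ρ :=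
    closure_minimal (fun y hy => ⟨Metric.ball_subset_closedBall hy.1,
      fun h => hy.2 (Metric.ball_subset_closedBall h)⟩)
      (Metric.isClosed_closedBall.sdiff Metric.isOpen_ball)
  have hne : ∀ y ∈ closure D, y ≠ a := fun y hy h =>
    (hcl hy).2 (by rw [h]; exact Metric.mem_ball_self hρ0)
  have hUD : ∀ y ∈ closure D, y ∈ U := fun y hy => hU (hcl hy).1
  have hz2 : ∀ y ∈ closure D, ContDiffAt ℝ 2 (fun y => w y + (-δ) * b y) y := fun y hy =>
    (hw y (hUD y hy)).add (contDiffAt_const.mul (hb2 y (hne y hy)))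
  have hzc : ContinuousOn (fun y => w y + (-δ) * b y) (closure D) := fun y hy =>
    (hz2 y hy).continuousAt.continuousWithinAt
  have hmain := nonneg_of_superharmonic hd hDo hDb a (w := fun y => w y + (-δ) * b y)
    (fun y hy => hz2 y (subset_closure hy.1))
    (fun y hy => by
      have hy' := subset_closure hy.1
      rw [laplacian_add_const_mul _ (hw y (hUD y hy')) (hb2 y (hne y hy'))]
      have := hΔ y (hUD y hy')
      have := mul_nonneg hδ0.le (hbΔ y (hne y hy'))
      linarith)
    ((hDb.isCompact_closure.bddBelow_image hzc).mono
      (image_mono (sdiff_subset.trans subset_closure)))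
    (hzc.mono sdiff_subset)
    (fun y hy hya => by
      have hyc := frontier_subset_closure hy
      have hyd := hcl hyc
      have hn : y ∉ D := by
        rw [frontier, hDo.interior_eq] at hy
        exact hy.2
      have hw0 := h0 y (hUD y hyc)
      simp only [Metric.mem_closedBall, Metric.mem_ball, not_lt, dist_eq_norm, Set.mem_sdiff] at hyd
      simp only [hDdef, Metric.mem_closedBall, Metric.mem_ball, not_le, dist_eq_norm, Set.mem_sdiff,
        not_and_or, not_lt] at hn
      rcases hn with hn | hn
      · have : ‖y - a‖ = R := le_antisymm hyd.1 hn
        simp [hbdef, g, this, hw0]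
      · have hyρ : ‖y - a‖ = ρ := le_antisymm hn hyd.2
        have h1 : w a / 2 < w y := hrw y (by simpa [dist_eq_norm, hyρ] using hρr)
        have h2 : b y ≤ (ρ ^ 2) ^ (-(d : ℤ)) := by
          simp only [hbdef, g, hyρ, add_zero]
          have : 0 < (R ^ 2) ^ (-(d : ℤ)) := by positivity
          linarith
        have h3 : δ * b y ≤ w a / 2 := by
          refine (mul_le_mul_of_nonneg_left h2 hδ0.le).trans_eq ?_
          rw [hδ, div_mul_cancel₀]
          positivity
        linarith)
  have hxa : x ≠ a := by
    rintro rfl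
    exact hxr (Metric.mem_ball_self hr)
  have hxD : x ∈ D := ⟨hx, fun h => hxr (Metric.closedBall_subset_ball hρr h)⟩
  have h1 := hmain x ⟨hxD, hxa⟩
  have h2 : 0 < b x := by
    have hlt : ‖x - a‖ ^ 2 < R ^ 2 := by
      have : ‖x - a‖ < R := by simpa [dist_eq_norm] using hx
      gcongr
    have hx0 := hpos x hxa
    simp only [hbdef, g, add_zero, sub_pos, zpow_neg, zpow_natCast] at hx0 ⊢
    have : (‖x - a‖ ^ 2) ^ d < (R ^ 2) ^ d := pow_lt_pow_left₀ hlt hx0.le (by omega)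
    have : 0 < (‖x - a‖ ^ 2) ^ d := by positivity
    gcongr
  have := mul_pos hδ0 h2
  linarith

/-- The positivity set of a nonnegative superharmonic function is relatively closed. -/
theorem closure_pos_inter_subset (hd : 2 ≤ Module.finrank ℝ E) {U : Set E} (hUo : IsOpen U)
    {w : E → ℝ} (hw : ∀ x ∈ U, ContDiffAt ℝ 2 w x) (hΔ : ∀ x ∈ U, Δ w x ≤ 0)
    (h0 : ∀ x ∈ U, 0 ≤ w x) : closure {x ∈ U | 0 < w x} ∩ U ⊆ {x ∈ U | 0 < w x} := by
  rintro x ⟨hxc, hxU⟩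
  obtain ⟨r, hr, hrU⟩ := Metric.isOpen_iff.1 hUo x hxU
  obtain ⟨a, ha, hxa⟩ := Metric.mem_closure_iff.1 hxc (r / 3) (by positivity)
  refine ⟨hxU, pos_of_superharmonic_ball hd hw hΔ h0 (a := a) (R := r / 3) ?_ ha.2 x hxa⟩
  intro y hy
  refine hrU ?_
  have h1 := dist_triangle y a x
  rw [dist_comm] at hxa
  simp only [Metric.mem_closedBall, Metric.mem_ball] at hy ⊢
  linarith

/-- The strong maximum principle along a preconnected set. -/
theorem pos_of_superharmonic (hd : 2 ≤ Module.finrank ℝ E) {U S : Set E} (hUo : IsOpen U)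
    {w : E → ℝ} (hw : ∀ x ∈ U, ContDiffAt ℝ 2 w x) (hΔ : ∀ x ∈ U, Δ w x ≤ 0)
    (h0 : ∀ x ∈ U, 0 ≤ w x) (hS : IsPreconnected S) (hSU : S ⊆ U) {y : E} (hy : y ∈ S)
    (hwy : 0 < w y) : ∀ x ∈ S, 0 < w x := by
  have hopen : IsOpen {x ∈ U | 0 < w x} :=
    ContinuousOn.isOpen_inter_preimage (fun x hx => (hw x hx).continuousAt.continuousWithinAt)
      hUo isOpen_Ioi
  have := hS.subset_of_closure_inter_subset hopen ⟨y, hy, hSU hy, hwy⟩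
    fun x hx => closure_pos_inter_subset hd hUo hw hΔ h0 ⟨hx.1, hSU hx.2⟩
  exact fun x hx => (this hx).2

end MaximumPrinciple

/-! ### Small superharmonic potentials of sets of small measure. -/

section Potential

open Laplacian MeasureTheory

theorem hasDerivAt_integral_rpow_left (p : ℝ) {T t : ℝ} (hT : 0 < T) (ht : 0 < t) :
    HasDerivAt (fun t => ∫ s in t..T, s ^ p) (-t ^ p) t := by
  have hc : ContinuousOn (fun s : ℝ => s ^ p) (Ioi 0) := fun s hs =>
    (Real.continuousAt_rpow_const s p (Or.inl (ne_of_gt hs))).continuousWithinAt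
  refine intervalIntegral.integral_hasDerivAt_left ?_ ?_ (hc.continuousAt (Ioi_mem_nhds ht))
  · refine (hc.mono fun s hs => ?_).intervalIntegrable
    exact (lt_min ht hT).trans_le hs.1
  · exact hc.stronglyMeasurableAtFilter isOpen_Ioi t ht

theorem contDiffAt_integral_rpow_left (p : ℝ) {T t : ℝ} (hT : 0 < T) (ht : 0 < t) :
    ContDiffAt ℝ 2 (fun t => ∫ s in t..T, s ^ p) t := by
  have h : ContDiffOn ℝ (1 + 1) (fun t => ∫ s in t..T, s ^ p) (Ioi 0) := by
    rw [contDiffOn_succ_iff_deriv_of_isOpen isOpen_Ioi]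
    refine ⟨fun s hs =>
      (hasDerivAt_integral_rpow_left p hT hs).differentiableAt.differentiableWithinAt, by simp, ?_⟩
    have : ContDiffOn ℝ 1 (fun s : ℝ => -s ^ p) (Ioi 0) := fun s hs =>
      (Real.contDiffAt_rpow_const_of_ne (ne_of_gt hs)).neg.contDiffWithinAt
    exact this.congr fun s hs => (hasDerivAt_integral_rpow_left p hT hs).deriv
  exact h.contDiffAt (Ioi_mem_nhds ht)

theorem integral_rpow_nonneg_left (p : ℝ) {T t : ℝ} (ht : 0 < t) (htT : t ≤ T) :
    0 ≤ ∫ s in t..T, s ^ p :=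
  intervalIntegral.integral_nonneg htT fun _ hs => Real.rpow_nonneg (ht.le.trans hs.1) _

theorem intervalIntegrable_rpow_of_pos (p : ℝ) {a b : ℝ} (ha : 0 < a) (hb : 0 < b) :
    IntervalIntegrable (fun s : ℝ => s ^ p) volume a b := by
  refine ContinuousOn.intervalIntegrable fun s hs => ?_
  exact (Real.continuousAt_rpow_const s p
    (Or.inl (ne_of_gt ((lt_min ha hb).trans_le hs.1)))).continuousWithinAt

theorem integral_rpow_anti_left (p : ℝ) {T s t : ℝ} (hs : 0 < s) (hst : s ≤ t) (htT : t ≤ T) :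
    ∫ r in t..T, r ^ p ≤ ∫ r in s..T, r ^ p := by
  have ht := hs.trans_le hst
  rw [← intervalIntegral.integral_add_adjacent_intervals
    (intervalIntegrable_rpow_of_pos p hs ht)
    (intervalIntegrable_rpow_of_pos p ht (ht.trans_le htT))]
  linarith [integral_rpow_nonneg_left p hs hst]

/-- Half a power is given away: `s^(p + 1/2)` is largest at `s = t`, and the remaining `s^(-1/2)` is
integrable at 0. The loss absorbs the logarithm that occurs for `p = -1`, that is, in dimension 2.
-/
theorem integral_rpow_le_left {p T t : ℝ} (hp : p ≤ -(1 / 2)) (ht : 0 < t) (htT : t ≤ T) :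
    ∫ s in t..T, s ^ p ≤ 2 * Real.sqrt T * t ^ (p + 1 / 2) := by
  have hT := ht.trans_le htT
  have h1 : ∫ s in t..T, s ^ p ≤ ∫ s in t..T, t ^ (p + 1 / 2) * s ^ (-(1 / 2) : ℝ) := by
    refine intervalIntegral.integral_mono_on htT (intervalIntegrable_rpow_of_pos p ht hT)
      ((intervalIntegrable_rpow_of_pos _ ht hT).const_mul _) fun s hs => ?_
    have hs0 := ht.trans_le hs.1
    have : s ^ p = s ^ (p + 1 / 2) * s ^ (-(1 / 2) : ℝ) := by
      rw [← Real.rpow_add hs0]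
      ring_nf
    rw [this]
    gcongr ?_ * _
    exact Real.rpow_le_rpow_of_nonpos ht hs.1 (by linarith)
  refine h1.trans ?_
  rw [intervalIntegral.integral_const_mul, integral_rpow (Or.inl (by norm_num)), mul_comm]
  gcongr
  rw [show (-(1 / 2) + 1 : ℝ) = 1 / 2 by norm_num, ← Real.sqrt_eq_rpow, ← Real.sqrt_eq_rpow]
  have := Real.sqrt_nonneg t
  linarith

variable {E : Type*} [NormedAddCommGroup E] [InnerProductSpace ℝ E] [FiniteDimensional ℝ E]

/-- Regularised fundamental solutions of the Laplacian at scale `η`. -/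
theorem exists_regularized_kernel (hd : 2 ≤ Module.finrank ℝ E) {R : ℝ} :
    ∃ C > 0, ∃ c > 0, ∀ η, 0 < η → η ≤ 1 → ∃ k : E → E → ℝ, ∀ y,
      (∀ x, ContDiffAt ℝ 2 (k y) x) ∧ (∀ x, Δ (k y) x ≤ 0) ∧
      (∀ x, ‖x - y‖ ≤ η → Δ (k y) x ≤ -(c / η ^ Module.finrank ℝ E)) ∧
      ∀ x, ‖x - y‖ ≤ R → 0 ≤ k y x ∧ ∀ z, ‖z - y‖ ≤ η → x ≠ z →
        k y x ≤ C * ‖x - z‖ ^ (1 - Module.finrank ℝ E : ℝ) := by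
  set d := Module.finrank ℝ E with hdd
  have hd2 : (2 : ℝ) ≤ d := by exact_mod_cast hd
  set T : ℝ := R ^ 2 + 1
  have hT : 0 < T := by positivity
  set p : ℝ := -(d / 2) with hp
  -- The integral of `s ^ (-d/2)` up to `T` is, up to constants, the fundamental solution in the
  -- variable `s = ‖x - y‖ ^ 2`, logarithmic or a power according to the dimension. The shift by `η
  -- ^ 2` removes the singularity and spreads its mass over the scale `η`; `T = R ^ 2 + 1` keeps the
  -- shifted variable below `T`.
  refine ⟨2 * Real.sqrt T * (2⁻¹ : ℝ) ^ (p + 1 / 2), by positivity, 2 * d * 2 ^ (p - 1),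
    by positivity, fun η hη hη1 => ⟨fun y x => (fun t => ∫ s in t..T, s ^ p) (‖x - y‖ ^ 2 + η ^ 2),
      fun y => ?_⟩⟩
  have ht0 : ∀ x : E, 0 < ‖x - y‖ ^ 2 + η ^ 2 := fun x => by positivity
  have hΔ : ∀ x, Δ (fun x => (fun t => ∫ s in t..T, s ^ p) (‖x - y‖ ^ 2 + η ^ 2)) x
      = -(2 * d * η ^ 2 * (‖x - y‖ ^ 2 + η ^ 2) ^ (p - 1)) := by
    intro x
    have h := ht0 x
    rw [laplacian_comp_norm_sq (g₁ := fun t => -t ^ p)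
      ((lt_mem_nhds h).mono fun t ht => hasDerivAt_integral_rpow_left p hT ht)
      (Real.hasDerivAt_rpow_const (Or.inl h.ne')).neg]
    have e : (‖x - y‖ ^ 2 + η ^ 2) ^ p
        = (‖x - y‖ ^ 2 + η ^ 2) ^ (p - 1) * (‖x - y‖ ^ 2 + η ^ 2) := by
      rw [← Real.rpow_add_one h.ne']
      ring_nf
    rw [e, hp, ← hdd]
    ring
  refine ⟨fun x => contDiffAt_comp_norm_sq (contDiffAt_integral_rpow_left p hT (ht0 x)),
    fun x => ?_, fun x hx => ?_, fun x hx => ⟨?_, fun z hz hxz => ?_⟩⟩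
  · rw [hΔ]
    have := ht0 x
    have : 0 ≤ 2 * d * η ^ 2 * (‖x - y‖ ^ 2 + η ^ 2) ^ (p - 1) := by positivity
    linarith
  · rw [hΔ, neg_le_neg_iff]
    have h1 : ‖x - y‖ ^ 2 + η ^ 2 ≤ 2 * η ^ 2 := by
      have : ‖x - y‖ ^ 2 ≤ η ^ 2 := by gcongr
      linarith
    have h2 := Real.rpow_le_rpow_of_nonpos (ht0 x) h1 (show p - 1 ≤ 0 by linarith)
    have h3 : (2 * η ^ 2) ^ (p - 1) = 2 ^ (p - 1) * (η ^ d)⁻¹ * (η ^ 2)⁻¹ := by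
      rw [Real.mul_rpow (by norm_num) (by positivity), ← Real.rpow_natCast, ← Real.rpow_natCast,
        ← Real.rpow_neg hη.le, ← Real.rpow_neg hη.le, ← Real.rpow_mul hη.le, mul_assoc,
        ← Real.rpow_add hη, hp]
      push_cast
      ring_nf
    rw [h3] at h2
    calc 2 * d * 2 ^ (p - 1) / η ^ d
        = 2 * d * η ^ 2 * (2 ^ (p - 1) * (η ^ d)⁻¹ * (η ^ 2)⁻¹) := by field_simp
      _ ≤ _ := by gcongr
  · refine integral_rpow_nonneg_left p (ht0 x) ?_
    have h1 : ‖x - y‖ ^ 2 ≤ R ^ 2 := by gcongr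
    have h2 : η ^ 2 ≤ 1 := pow_le_one₀ hη.le hη1
    linarith
  · have htT : ‖x - y‖ ^ 2 + η ^ 2 ≤ T := by
      have h1 : ‖x - y‖ ^ 2 ≤ R ^ 2 := by gcongr
      have h2 : η ^ 2 ≤ 1 := pow_le_one₀ hη.le hη1
      linarith
    have hxz0 : 0 < ‖x - z‖ := norm_pos_iff.2 (sub_ne_zero.2 hxz)
    have hle : ‖x - z‖ ^ 2 * 2⁻¹ ≤ ‖x - y‖ ^ 2 + η ^ 2 := by
      have h1 : ‖x - z‖ ≤ ‖x - y‖ + η := by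
        have := norm_sub_le_norm_sub_add_norm_sub x y z
        rw [norm_sub_rev y z] at this
        linarith
      have h2 : ‖x - z‖ ^ 2 ≤ (‖x - y‖ + η) ^ 2 := by gcongr
      nlinarith [sq_nonneg (‖x - y‖ - η)]
    have hs : 0 < ‖x - z‖ ^ 2 * 2⁻¹ := by positivity
    refine (integral_rpow_anti_left p hs hle htT).trans ?_
    refine (integral_rpow_le_left (by linarith) hs (hle.trans htT)).trans_eq ?_
    rw [Real.mul_rpow (by positivity) (by norm_num), ← Real.rpow_natCast, ← Real.rpow_mul hxz0.le,
      hp]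
    push_cast
    ring_nf

/-- Among finitely many points one can select separated ones that are close to all the others. -/
theorem exists_separated_finset {X : Type*} [PseudoMetricSpace X] (r : ℝ) (hr : 0 < r)
    (t : Finset X) : ∃ F ⊆ t, (∀ x ∈ F, ∀ y ∈ F, x ≠ y → r ≤ dist x y) ∧
      ∀ x ∈ t, ∃ y ∈ F, dist x y < r := by
  classical
  induction t using Finset.induction_on with
  | empty => exact ⟨∅, by simp, by simp, by simp⟩
  | insert a t ha ih =>
    obtain ⟨F, hFt, hsep, hcov⟩ := ih
    by_cases h : ∃ y ∈ F, dist a y < r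
    · refine ⟨F, hFt.trans (Finset.subset_insert _ _), hsep, fun x hx => ?_⟩
      rcases Finset.mem_insert.1 hx with rfl | hx
      · exact h
      · exact hcov x hx
    · push Not at h
      refine ⟨insert a F, Finset.insert_subset_insert _ hFt, fun x hx y hy hxy => ?_,
        fun x hx => ?_⟩
      · rcases Finset.mem_insert.1 hx with rfl | hx' <;>
          rcases Finset.mem_insert.1 hy with rfl | hy'
        · exact absurd rfl hxy
        · exact h y hy'
        · rw [dist_comm]
          exact h x hx'
        · exact hsep x hx' y hy' hxy
      · rcases Finset.mem_insert.1 hx with rfl | hx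
        · exact ⟨x, Finset.mem_insert_self _ _, by simpa using hr⟩
        · obtain ⟨y, hy, hxy⟩ := hcov x hx
          exact ⟨y, Finset.mem_insert_of_mem hy, hxy⟩

variable [MeasurableSpace E] [BorelSpace E]

/-- In polar coordinates `r^(d-1)` cancels `r^(1-d)`, so the kernel is integrable on balls and its
integral is absolutely continuous. The substitution `z ↦ x - z` reduces every `x` to this one
function, which makes `δ` independent of `x`. -/
theorem exists_measure_lt_setLIntegral_norm_rpow_lt (hd : 2 ≤ Module.finrank ℝ E) (C ρ : ℝ)
    {ε : ENNReal} (hε : ε ≠ 0) : ∃ δ > 0, ∀ U : Set E, MeasurableSet U → volume U < δ → ∀ x : E,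
      ∫⁻ z in U ∩ Metric.ball x ρ,
        ENNReal.ofReal (C * ‖x - z‖ ^ (1 - Module.finrank ℝ E : ℝ)) < ε := by
  have : Nontrivial E := Module.nontrivial_of_finrank_pos (R := ℝ) (by omega)
  set d := Module.finrank ℝ E
  set h : E → ENNReal := fun v => ENNReal.ofReal (C * ‖v‖ ^ (1 - d : ℝ)) with hh
  have hmeas : Measurable h := by
    refine ENNReal.measurable_ofReal.comp (measurable_const.mul ?_)
    exact measurable_norm.pow_const _
  have hint : IntegrableOn (fun v : E => C * ‖v‖ ^ (1 - d : ℝ)) (Metric.ball 0 ρ) volume := by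
    rw [integrableOn_fun_norm_addHaar volume (f := fun s => C * s ^ (1 - d : ℝ))]
    refine (integrableOn_const (C := C) (by simp)).congr_fun (fun s hs => ?_) measurableSet_Ioo
    have hs0 : 0 < s := hs.1
    have : s ^ (d - 1) * s ^ (1 - d : ℝ) = 1 := by
      rw [← Real.rpow_natCast, ← Real.rpow_add hs0, Nat.cast_sub (by omega)]
      simp
    change C = s ^ (d - 1) * (C * s ^ (1 - d : ℝ))
    linear_combination -C * this
  have hfin : ∫⁻ v, h v ∂(volume.restrict (Metric.ball 0 ρ)) ≠ ⊤ :=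
    (hint.lintegral_lt_top).ne
  obtain ⟨δ, hδ, H⟩ := exists_pos_setLIntegral_lt_of_measure_lt hfin hε
  refine ⟨δ, hδ, fun U hU hUδ x => ?_⟩
  have hmp : MeasurePreserving (fun z : E => x - z) volume volume :=
    Measure.measurePreserving_sub_left volume x
  set s : Set E := (fun z : E => x - z) ⁻¹' U with hs
  have hsm : MeasurableSet s := hmp.measurable hU
  have hsδ : volume.restrict (Metric.ball 0 ρ) s < δ :=
    (Measure.restrict_apply_le _ _).trans_lt (by rwa [hs, hmp.measure_preimage hU.nullMeasurableSet])
  have := H s hsδ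
  rw [Measure.restrict_restrict hsm,
    ← hmp.setLIntegral_comp_preimage (hsm.inter measurableSet_ball) hmeas] at this
  convert this using 3
  ext z
  simp [hs, dist_eq_norm, norm_sub_rev]

/-- Sets of small measure carry small superharmonic potentials. -/
theorem exists_small_potential (hd : 2 ≤ Module.finrank ℝ E) {ε R : ℝ} (hε : 0 < ε) :
    ∃ δ > 0, ∀ D : Set E, IsCompact D → D ⊆ Metric.ball 0 R → volume D < δ →
      ∃ φ : E → ℝ, (∀ x, ContDiffAt ℝ 2 φ x) ∧ (∀ x, Δ φ x ≤ 0) ∧ (∀ x ∈ D, Δ φ x ≤ -1) ∧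
        ∀ x ∈ Metric.ball 0 R, 0 ≤ φ x ∧ φ x ≤ ε := by
  have : Nontrivial E := Module.nontrivial_of_finrank_pos (R := ℝ) (by omega)
  obtain ⟨C, hC, c, hc, hk⟩ := exists_regularized_kernel (E := E) hd (R := 2 * R)
  set d := Module.finrank ℝ E
  set ω : ℝ := (volume (Metric.ball (0 : E) 1)).toReal with hω
  have hω0 : 0 < ω := ENNReal.toReal_pos (Metric.measure_ball_pos _ _ one_pos).ne'
    measure_ball_lt_top.ne
  -- Chosen so that the weight `a` below, `A` times the volume of a ball of radius `η / 4`,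
  -- satisfies `a * (c / η ^ d) = 1`.
  set A : ℝ := 4 ^ d / (ω * c) with hA
  have hA0 : 0 < A := by positivity
  obtain ⟨δ, hδ, H⟩ := exists_measure_lt_setLIntegral_norm_rpow_lt (E := E) hd C (2 * R + 1)
    (ε := ENNReal.ofReal (ε / A)) (by simpa using by positivity)
  refine ⟨δ, hδ, fun D hD hDR hDδ => ?_⟩
  obtain ⟨U, hDU, hUo, hUδ⟩ := D.exists_isOpen_lt_of_lt δ hDδ
  obtain ⟨η₀, hη₀, hη₀U⟩ := hD.exists_thickening_subset_open hUo hDU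
  set η := min η₀ 1 with hηdef
  have hη : 0 < η := by positivity
  have hη1 : η ≤ 1 := min_le_right _ _
  obtain ⟨k, hk⟩ := hk η hη hη1
  obtain ⟨t, htD, htfin, htc⟩ := hD.finite_cover_balls (half_pos hη)
  -- Every point of `D` is within `η` of a centre in `F`, where a single kernel already gives `Δ φ ≤
  -- -1`. The balls of radius `η / 4` about the centres are disjoint and lie in `U`.
  obtain ⟨F, hFt, hsep, hcov⟩ := exists_separated_finset (η / 2) (half_pos hη) htfin.toFinset
  have hFD : ∀ y ∈ F, y ∈ D := fun y hy => htD (htfin.mem_toFinset.1 (hFt hy))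
  have hvol : ∀ y : E, volume (Metric.ball y (η / 4)) = ENNReal.ofReal ((η / 4) ^ d * ω) := by
    intro y
    rw [Measure.addHaar_ball _ _ (by positivity), ENNReal.ofReal_mul (by positivity), hω,
      ENNReal.ofReal_toReal measure_ball_lt_top.ne]
  set a : ℝ := A * ((η / 4) ^ d * ω) with ha
  have ha0 : 0 < a := by positivity
  have hac : a * (c / η ^ d) = 1 := by
    rw [ha, hA, div_pow]
    field_simp
  have hφ2 : ∀ x, ContDiffAt ℝ 2 (fun x => ∑ y ∈ F, a * k y x) x := fun x =>
    ContDiffAt.sum fun y _ => contDiffAt_const.mul ((hk y).1 x)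
  have hφΔ : ∀ x, Δ (fun x => ∑ y ∈ F, a * k y x) x = ∑ y ∈ F, a * Δ (k y) x := by
    intro x
    clear hφ2 hFD hcov hsep hFt
    classical
    induction F using Finset.induction_on with
    | empty => simp
    | insert y F hy ih =>
      rw [Finset.sum_insert hy, ← ih]
      have h1 : ContDiffAt ℝ 2 (fun x => ∑ y ∈ F, a * k y x) x :=
        ContDiffAt.sum fun y _ => contDiffAt_const.mul ((hk y).1 x)
      rw [add_comm, ← laplacian_add_const_mul a h1 ((hk y).1 x)]
      refine congrArg (fun g : E → ℝ => Δ g x) (funext fun x' => ?_)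
      rw [Finset.sum_insert hy, add_comm]
  refine ⟨fun x => ∑ y ∈ F, a * k y x, hφ2, fun x => ?_, fun x hx => ?_, fun x hx => ?_⟩
  · rw [hφΔ]
    exact Finset.sum_nonpos fun y _ => mul_nonpos_of_nonneg_of_nonpos ha0.le ((hk y).2.1 x)
  · rw [hφΔ]
    obtain ⟨x', hx', hxx'⟩ := mem_iUnion₂.1 (htc hx)
    obtain ⟨y, hy, hxy⟩ := hcov x' (htfin.mem_toFinset.2 hx')
    have hxyη : ‖x - y‖ ≤ η := by
      rw [← dist_eq_norm]
      have := dist_triangle x x' y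
      rw [Metric.mem_ball] at hxx'
      linarith
    have h1 := Finset.single_le_sum (f := fun y => -(a * Δ (k y) x)) (fun y _ => by
      have := mul_nonpos_of_nonneg_of_nonpos ha0.le ((hk y).2.1 x)
      linarith) hy
    rw [Finset.sum_neg_distrib] at h1
    have h2 := mul_le_mul_of_nonneg_left ((hk y).2.2.1 x hxyη) ha0.le
    rw [mul_neg, hac] at h2
    linarith
  · have hxy : ∀ y ∈ F, ‖x - y‖ ≤ 2 * R := fun y hy => by
      have h1 : ‖x‖ < R := by simpa using hx
      have h2 : ‖y‖ < R := by simpa using hDR (hFD y hy)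
      linarith [norm_sub_le x y]
    have hk0 : ∀ y ∈ F, 0 ≤ k y x := fun y hy => ((hk y).2.2.2 x (hxy y hy)).1
    refine ⟨Finset.sum_nonneg fun y hy => mul_nonneg ha0.le (hk0 y hy), ?_⟩
    have hball : ∀ y ∈ F, Metric.ball y (η / 4) ⊆ U ∩ Metric.ball x (2 * R + 1) := by
      intro y hy z hz
      rw [Metric.mem_ball] at hz
      refine ⟨hη₀U (Metric.mem_thickening_iff.2 ⟨y, hFD y hy, ?_⟩), ?_⟩
      · have : η ≤ η₀ := min_le_left _ _
        linarith
      · have h1 := dist_triangle z y x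
        have h2 := hxy y hy
        rw [← dist_eq_norm, dist_comm] at h2
        rw [Metric.mem_ball]
        linarith
    set h : E → ENNReal := fun z => ENNReal.ofReal (C * ‖x - z‖ ^ (1 - d : ℝ)) with hh
    -- The bound on `k y x` holds for all `z` in the ball about `y`, so it can be integrated over
    -- that ball. By disjointness the finite sum is then at most the integral over `U`, like a
    -- Riemann sum for the potential of `U`.
    have hterm : ∀ y ∈ F, ENNReal.ofReal ((η / 4) ^ d * ω * k y x)
        ≤ ∫⁻ z in Metric.ball y (η / 4), h z := by
      intro y hy
      have hcomp : ∀ᵐ z ∂(volume.restrict (Metric.ball y (η / 4))),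
          ENNReal.ofReal (k y x) ≤ h z := by
        rw [ae_restrict_iff' measurableSet_ball]
        filter_upwards [compl_mem_ae_iff.2 (measure_singleton (μ := (volume : Measure E)) x)]
          with z hz hzy
        refine ENNReal.ofReal_le_ofReal (((hk y).2.2.2 x (hxy y hy)).2 z ?_ fun h => hz h.symm)
        rw [Metric.mem_ball, dist_eq_norm] at hzy
        linarith
      refine le_trans (le_of_eq ?_) (lintegral_mono_ae hcomp)
      rw [lintegral_const, Measure.restrict_apply_univ, hvol, mul_comm,
        ENNReal.ofReal_mul' (by positivity)]
    have hdisj : (F : Set E).PairwiseDisjoint fun y => Metric.ball y (η / 4) := by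
      intro y hy y' hy' hne
      exact Metric.ball_disjoint_ball (by linarith [hsep y hy y' hy' hne])
    have hsum : ENNReal.ofReal (∑ y ∈ F, (η / 4) ^ d * ω * k y x) ≤ ENNReal.ofReal (ε / A) := by
      rw [ENNReal.ofReal_sum_of_nonneg fun y hy => mul_nonneg (by positivity) (hk0 y hy)]
      refine (Finset.sum_le_sum hterm).trans ?_
      rw [← lintegral_biUnion_finset hdisj fun y _ => measurableSet_ball]
      refine (lintegral_mono_set (iUnion₂_subset hball)).trans ?_
      exact (H U hUo.measurableSet hUδ x).le
    rw [ENNReal.ofReal_le_ofReal_iff (by positivity), le_div_iff₀ hA0] at hsum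
    calc ∑ y ∈ F, a * k y x = (∑ y ∈ F, (η / 4) ^ d * ω * k y x) * A := by
          rw [Finset.sum_mul]
          exact Finset.sum_congr rfl fun y _ => by rw [ha]; ring
      _ ≤ ε := hsum

end Potential

/-! ### Caps, reflections and the differences `planeDiff`. -/

section MovingPlanes

open Laplacian MeasureTheory

variable {E : Type*} [NormedAddCommGroup E] [InnerProductSpace ℝ E]

/-- An open bounded set which, with each point, contains all the points on the
parallel to the direction `e` through it that are at most as far from the hyperplane `e^⊥`. -/
structure IsSteinerDomain (e : E) (Ω : Set E) : Prop where
  norm_eq : ‖e‖ = 1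
  isOpen : IsOpen Ω
  isBounded : Bornology.IsBounded Ω
  slide : ∀ x ∈ Ω, ∀ t : ℝ, |t| ≤ |inner ℝ e x| → x + (t - inner ℝ e x) • e ∈ Ω

/-- The reflection in the hyperplane `⟪e, x⟫ = l`. -/
noncomputable def planeReflection (e : E) (l : ℝ) (x : E) : E := x + (2 * (l - inner ℝ e x)) • e

/-- The part of `Ω` beyond the hyperplane `⟪e, x⟫ = l`. -/
def cap (e : E) (Ω : Set E) (l : ℝ) : Set E := {x ∈ Ω | l < inner ℝ e x}

/-- The difference between the reflection of `v` in the hyperplane `⟪e, x⟫ = l` and `v`. -/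
noncomputable def planeDiff (e : E) (v : E → ℝ) (l : ℝ) (x : E) : ℝ :=
  v (planeReflection e l x) - v x

section Reflection

variable {e : E} {Ω : Set E} {l : ℝ} {x : E}

theorem inner_planeReflection (he : ‖e‖ = 1) (l : ℝ) (x : E) :
    inner ℝ e (planeReflection e l x) = 2 * l - inner ℝ e x := by
  rw [planeReflection, inner_add_right, inner_smul_right, real_inner_self_eq_norm_sq, he]
  ring

theorem planeReflection_planeReflection (he : ‖e‖ = 1) (l : ℝ) (x : E) :
    planeReflection e l (planeReflection e l x) = x := by
  rw [planeReflection, inner_planeReflection he, planeReflection]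
  module

theorem planeReflection_ne_zero (he : ‖e‖ = 1) (hx : x ≠ planeReflection e l 0) :
    planeReflection e l x ≠ 0 := fun h => by
  rw [← h, planeReflection_planeReflection he] at hx
  exact hx rfl

theorem continuous_planeReflection (e : E) :
    Continuous fun q : ℝ × E => planeReflection e q.1 q.2 := by
  unfold planeReflection
  fun_prop

theorem add_smul_ne_smul (he : ‖e‖ = 1) (hx : x ≠ (inner ℝ e x : ℝ) • e) (c r : ℝ) :
    x + c • e ≠ r • e := fun h => by
  have h1 : x = (r - c) • e := by rw [sub_smul, ← h]; abel
  apply hx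
  rw [h1, inner_smul_right, real_inner_self_eq_norm_sq, he]
  norm_num

theorem IsSteinerDomain.isOpen_cap (hΩ : IsSteinerDomain e Ω) (l : ℝ) : IsOpen (cap e Ω l) :=
  have h : IsOpen {x : E | l < inner ℝ e x} :=
    isOpen_lt continuous_const (continuous_const.inner continuous_id)
  hΩ.isOpen.inter h

theorem IsSteinerDomain.isBounded_cap (hΩ : IsSteinerDomain e Ω) (l : ℝ) :
    Bornology.IsBounded (cap e Ω l) :=
  hΩ.isBounded.subset fun _ hx => hx.1

theorem IsSteinerDomain.planeReflection_mem (hΩ : IsSteinerDomain e Ω) (hl : 0 < l)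
    (hx : x ∈ cap e Ω l) : planeReflection e l x ∈ Ω := by
  have h1 := hx.2
  have h := hΩ.slide x hx.1 (2 * l - inner ℝ e x) (by
    rw [abs_of_pos (hl.trans h1)]
    exact abs_le.2 ⟨by linarith, by linarith⟩)
  convert h using 1
  rw [planeReflection]
  ring_nf

theorem inner_ge_of_mem_closure_cap (hx : x ∈ closure (cap e Ω l)) : l ≤ inner ℝ e x :=
  have h : IsClosed {x : E | l ≤ inner ℝ e x} :=
    isClosed_le continuous_const (continuous_const.inner continuous_id)
  closure_minimal (fun y hy => (le_of_lt hy.2 : l ≤ inner ℝ e y)) h hx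

theorem ne_zero_of_inner_pos (hx : 0 < inner ℝ e x) : x ≠ 0 := by
  rintro rfl
  simp at hx

theorem IsSteinerDomain.mem_diff_of_mem_cap (hΩ : IsSteinerDomain e Ω) (hl : 0 < l)
    (hx : x ∈ cap e Ω l \ {planeReflection e l 0}) :
    x ∈ Ω \ {0} ∧ planeReflection e l x ∈ Ω \ {0} :=
  ⟨⟨hx.1.1, ne_zero_of_inner_pos (hl.trans hx.1.2)⟩, hΩ.planeReflection_mem hl hx.1,
    planeReflection_ne_zero hΩ.norm_eq hx.2⟩

theorem IsSteinerDomain.neg (hΩ : IsSteinerDomain e Ω) : IsSteinerDomain (-e) Ω where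
  norm_eq := by rw [norm_neg, hΩ.norm_eq]
  isOpen := hΩ.isOpen
  isBounded := hΩ.isBounded
  slide x hx t ht := by
    have := hΩ.slide x hx (-t) (by simpa using ht)
    convert this using 1
    rw [inner_neg_left]
    module

end Reflection

variable [FiniteDimensional ℝ E]

/-- A nonnegative solution, singular at most at `0` and continuously extended by `0` outside `Ω`,
of the system `-Δ V_j = V_{j+1}` for `j < k`, `-Δ V_k = f(V_0)`. -/
structure IsCooperativeSolution (k : ℕ) (Ω : Set E) (f : ℝ → ℝ) (V : ℕ → E → ℝ) : Prop where
  contDiffAt : ∀ j ≤ k, ∀ x ∈ Ω \ {0}, ContDiffAt ℝ 2 (V j) x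
  continuousAt : ∀ j ≤ k, ∀ x, x ≠ 0 → ContinuousAt (V j) x
  eq_zero : ∀ j ≤ k, ∀ x ∉ Ω, V j x = 0
  nonneg : ∀ j ≤ k, ∀ x, 0 ≤ V j x
  pos : ∀ x ∈ Ω \ {0}, 0 < V 0 x
  laplacian_lt : ∀ j < k, ∀ x ∈ Ω \ {0}, Δ (V j) x = -V (j + 1) x
  laplacian_last : ∀ x ∈ Ω \ {0}, Δ (V k) x = -f (V 0 x)

theorem laplacian_planeDiff {e : E} (he : ‖e‖ = 1) {v : E → ℝ} {l : ℝ} {x : E}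
    (h1 : ContDiffAt ℝ 2 v (planeReflection e l x)) (h2 : ContDiffAt ℝ 2 v x) :
    ContDiffAt ℝ 2 (planeDiff e v l) x ∧
      Δ (planeDiff e v l) x = Δ v (planeReflection e l x) - Δ v x := by
  have hA : ∀ y, (ℝ ∙ e)ᗮ.reflection y + (2 * l) • e = planeReflection e l y := fun y => by
    rw [Submodule.reflection_orthogonal_apply, Submodule.reflection_singleton_apply, he,
      planeReflection]
    simp only [RCLike.ofReal_real_eq_id, id, one_pow, div_one]
    module
  have hs : ContDiffAt ℝ 2 (fun y => planeReflection e l y) x :=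
    (contDiff_id.add ((contDiff_const.mul (contDiff_const.sub
      (contDiff_const.inner ℝ contDiff_id))).smul contDiff_const)).contDiffAt
  have h3 : ContDiffAt ℝ 2 (fun y => v (planeReflection e l y)) x := h1.comp x hs
  refine ⟨h3.sub h2, ?_⟩
  have h4 := laplacian_comp_affineIsometry (ℝ ∙ e)ᗮ.reflection ((2 * l) • e) (v := v) (x := x)
    (by rwa [hA])
  simp only [hA] at h4
  rw [← h4]
  exact h3.laplacian_sub h2

/-- The function `(ρ ^ 2 - ‖x‖ ^ 2) / (2 * d)` absorbs constant errors when bounds pass down the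
system. The `+ 1` in `C` only ensures that `C` is positive. -/
theorem exists_quadratic_barrier (hd : 2 ≤ Module.finrank ℝ E) (ρ : ℝ) :
    ∃ C > 0, ∃ q : E → ℝ, (∀ x, ContDiffAt ℝ 2 q x) ∧ (∀ x, Δ q x = -1) ∧
      ∀ x ∈ Metric.ball 0 ρ, 0 ≤ q x ∧ q x ≤ C := by
  have hd2 : (2 : ℝ) ≤ Module.finrank ℝ E := by exact_mod_cast hd
  set d := Module.finrank ℝ E with hdd
  refine ⟨(ρ ^ 2 + 1) / (2 * d), by positivity,
    fun x => (fun t => (ρ ^ 2 - t) / (2 * d)) (‖x - 0‖ ^ 2 + 0), fun x => ?_, fun x => ?_,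
    fun x hx => ?_⟩
  · exact contDiffAt_comp_norm_sq (g := fun t => (ρ ^ 2 - t) / (2 * d)) (by fun_prop)
  · rw [laplacian_comp_norm_sq (g := fun t => (ρ ^ 2 - t) / (2 * d))
      (g₁ := fun _ => (-1) / (2 * d)) (g₂ := 0)
      (Eventually.of_forall fun t => ((hasDerivAt_id t).const_sub _).div_const _)
      (hasDerivAt_const _ _), ← hdd]
    field_simp
    ring
  · have h1 : ‖x‖ < ρ := by simpa using hx
    have h2 : ‖x‖ ^ 2 ≤ ρ ^ 2 := by gcongr
    have h3 := sq_nonneg ‖x‖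
    simp only [sub_zero, add_zero]
    constructor
    · exact div_nonneg (by linarith) (by positivity)
    · gcongr
      linarith

variable {e : E} {Ω : Set E} {k : ℕ} {f : ℝ → ℝ} {V : ℕ → E → ℝ} {l : ℝ}

namespace IsCooperativeSolution

theorem laplacian_planeDiff (hV : IsCooperativeSolution k Ω f V) (hΩ : IsSteinerDomain e Ω)
    (hl : 0 < l) {j : ℕ} (hj : j ≤ k) {x : E} (hx : x ∈ cap e Ω l \ {planeReflection e l 0}) :
    ContDiffAt ℝ 2 (planeDiff e (V j) l) x ∧ Δ (planeDiff e (V j) l) x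
      = Δ (V j) (planeReflection e l x) - Δ (V j) x := by
  obtain ⟨h1, h2⟩ := hΩ.mem_diff_of_mem_cap hl hx
  exact _root_.laplacian_planeDiff hΩ.norm_eq (hV.contDiffAt j hj _ h2) (hV.contDiffAt j hj _ h1)

theorem continuousAt_planeDiff_prod (hV : IsCooperativeSolution k Ω f V) {j : ℕ} (hj : j ≤ k)
    {x : E} (hx : x ≠ 0) (hx' : planeReflection e l x ≠ 0) :
    ContinuousAt (fun q : ℝ × E => planeDiff e (V j) q.1 q.2) (l, x) := by
  have h1 : ContinuousAt (fun q : ℝ × E => planeReflection e q.1 q.2) (l, x) :=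
    (continuous_planeReflection e).continuousAt
  have h2 : ContinuousAt (Prod.snd : ℝ × E → E) (l, x) := continuousAt_snd
  exact ((hV.continuousAt j hj _ hx').tendsto.comp h1.tendsto).sub
    ((hV.continuousAt j hj _ hx).tendsto.comp h2.tendsto)

theorem continuousAt_planeDiff (hV : IsCooperativeSolution k Ω f V) {j : ℕ} (hj : j ≤ k)
    {x : E} (hx : x ≠ 0) (hx' : planeReflection e l x ≠ 0) :
    ContinuousAt (planeDiff e (V j) l) x :=
  ContinuousAt.comp (f := fun y : E => (l, y)) (hV.continuousAt_planeDiff_prod hj hx hx')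
    (by fun_prop)

theorem continuousOn_planeDiff (hV : IsCooperativeSolution k Ω f V) (hΩ : IsSteinerDomain e Ω)
    (hl : 0 < l) {j : ℕ} (hj : j ≤ k) :
    ContinuousOn (planeDiff e (V j) l) (closure (cap e Ω l) \ {planeReflection e l 0}) :=
  fun _ hx => (hV.continuousAt_planeDiff hj
    (ne_zero_of_inner_pos (hl.trans_le (inner_ge_of_mem_closure_cap hx.1)))
    (planeReflection_ne_zero hΩ.norm_eq hx.2)).continuousWithinAt

/-- On the hyperplane the difference vanishes; elsewhere the boundary point lies outside `Ω`, where
`V j = 0` and the reflected value is nonnegative. -/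
theorem planeDiff_nonneg_of_mem_frontier (hV : IsCooperativeSolution k Ω f V)
    (hΩ : IsSteinerDomain e Ω) {j : ℕ} (hj : j ≤ k) {y : E} (hy : y ∈ frontier (cap e Ω l)) :
    0 ≤ planeDiff e (V j) l y := by
  have h1 := inner_ge_of_mem_closure_cap (frontier_subset_closure hy)
  rw [frontier, (hΩ.isOpen_cap l).interior_eq] at hy
  rcases h1.eq_or_lt with h | h
  · simp [planeDiff, planeReflection, ← h]
  · have : y ∉ Ω := fun h' => hy.2 ⟨h', h⟩
    rw [planeDiff, hV.eq_zero j hj y this, sub_zero]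
    exact hV.nonneg j hj _

/-- This controls the singularity: the reflected term may be unbounded, but it is nonnegative, and
the subtracted term is bounded since the closed cap stays away from the origin. -/
theorem bddBelow_planeDiff (hV : IsCooperativeSolution k Ω f V) (hΩ : IsSteinerDomain e Ω)
    (hl : 0 < l) {j : ℕ} (hj : j ≤ k) :
    ∃ M, ∀ x ∈ cap e Ω l, -M ≤ planeDiff e (V j) l x := by
  obtain ⟨M, hM⟩ := (hΩ.isBounded_cap l).isCompact_closure.bddAbove_image (f := V j)
    fun x hx => (hV.continuousAt j hj x
      (ne_zero_of_inner_pos (hl.trans_le (inner_ge_of_mem_closure_cap hx)))).continuousWithinAt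
  refine ⟨M, fun x hx => ?_⟩
  have h1 := hM (mem_image_of_mem _ (subset_closure hx))
  have h2 := hV.nonneg j hj (planeReflection e l x)
  rw [planeDiff]
  linarith

/-- The maximum principle for the differences, with a correction term. -/
theorem planeDiff_add_nonneg (hd : 2 ≤ Module.finrank ℝ E) (hV : IsCooperativeSolution k Ω f V)
    (hΩ : IsSteinerDomain e Ω) (hl : 0 < l) {j : ℕ} (hj : j ≤ k) {ψ : E → ℝ}
    (hψ : ∀ x, ContDiffAt ℝ 2 ψ x) (hψ0 : ∀ x ∈ closure (cap e Ω l), 0 ≤ ψ x)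
    (hΔ : ∀ x ∈ cap e Ω l \ {planeReflection e l 0},
      Δ (V j) (planeReflection e l x) - Δ (V j) x + Δ ψ x ≤ 0) :
    ∀ x ∈ cap e Ω l \ {planeReflection e l 0}, 0 ≤ planeDiff e (V j) l x + ψ x := by
  refine nonneg_of_superharmonic hd (hΩ.isOpen_cap l) (hΩ.isBounded_cap l) _
    (fun x hx => (hV.laplacian_planeDiff hΩ hl hj hx).1.add (hψ x)) (fun x hx => ?_) ?_
    ((hV.continuousOn_planeDiff hΩ hl hj).add fun x _ => (hψ x).continuousAt.continuousWithinAt)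
    fun y hy _ => add_nonneg (hV.planeDiff_nonneg_of_mem_frontier hΩ hj hy)
      (hψ0 y (frontier_subset_closure hy))
  · obtain ⟨h1, h2⟩ := hV.laplacian_planeDiff hΩ hl hj hx
    have h3 := h1.laplacian_add (hψ x)
    rw [h2] at h3
    exact h3.trans_le (hΔ x hx)
  · obtain ⟨M, hM⟩ := hV.bddBelow_planeDiff hΩ hl hj
    refine ⟨-M, ?_⟩
    rintro _ ⟨x, hx, rfl⟩
    have := hψ0 x (subset_closure hx.1)
    have := hM x hx.1
    change -M ≤ planeDiff e (V j) l x + ψ x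
    linarith

/-- A lower bound for the last difference yields lower bounds for the previous ones. -/
theorem planeDiff_ge_of_last (hd : 2 ≤ Module.finrank ℝ E) (hV : IsCooperativeSolution k Ω f V)
    (hΩ : IsSteinerDomain e Ω) (hl : 0 < l) {C A : ℝ} (hC : 0 ≤ C) (hA : 0 ≤ A) {q : E → ℝ}
    (hq : ∀ x, ContDiffAt ℝ 2 q x) (hqΔ : ∀ x, Δ q x = -1)
    (hqC : ∀ x ∈ closure (cap e Ω l), 0 ≤ q x ∧ q x ≤ C)
    (hlast : ∀ x ∈ cap e Ω l \ {planeReflection e l 0}, -A ≤ planeDiff e (V k) l x) {i : ℕ} :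
    i ≤ k → ∀ x ∈ cap e Ω l \ {planeReflection e l 0},
      -(A * C ^ i) ≤ planeDiff e (V (k - i)) l x := by
  induction i with
  | zero => simpa using hlast
  | succ i ih =>
    intro hi x hx
    have hlt : k - (i + 1) < k := by omega
    have hsucc : k - (i + 1) + 1 = k - i := by omega
    have hB : 0 ≤ A * C ^ i := by positivity
    have h := hV.planeDiff_add_nonneg hd hΩ hl hlt.le (ψ := fun x => (A * C ^ i) * q x)
      (fun x => contDiffAt_const.mul (hq x))
      (fun x hx => mul_nonneg hB (hqC x hx).1) (fun x hx => ?_) x hx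
    · have := mul_le_mul_of_nonneg_left (hqC x (subset_closure hx.1)).2 hB
      rw [pow_succ, ← mul_assoc]
      linarith
    · obtain ⟨h1, h2⟩ := hΩ.mem_diff_of_mem_cap hl hx
      have h3 := InnerProductSpace.laplacian_smul (A * C ^ i) (hq x)
      have h4 : Δ (fun x => (A * C ^ i) * q x) x = A * C ^ i * Δ q x := h3
      rw [hV.laplacian_lt _ hlt _ h1, hV.laplacian_lt _ hlt _ h2, h4, hqΔ, hsucc]
      have h5 := ih (by omega) x hx
      rw [planeDiff] at h5
      linarith

/-- Monotonicity of `f` carries the sign from level 0 to level `k`; the linear equations then carry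
it down, by `planeDiff_ge_of_last` with `A = 0`. -/
theorem planeDiff_nonneg_of_zero (hd : 2 ≤ Module.finrank ℝ E)
    (hf : MonotoneOn f (Ici 0)) (hV : IsCooperativeSolution k Ω f V) (hΩ : IsSteinerDomain e Ω)
    (hl : 0 < l)
    (h0 : ∀ x ∈ cap e Ω l \ {planeReflection e l 0}, 0 ≤ planeDiff e (V 0) l x)
    {j : ℕ} (hj : j ≤ k) :
    ∀ x ∈ cap e Ω l \ {planeReflection e l 0}, 0 ≤ planeDiff e (V j) l x := by
  intro x hx
  obtain ⟨ρ, hρ⟩ := (hΩ.isBounded_cap l).closure.subset_ball 0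
  obtain ⟨C, hC, q, hq, hqΔ, hqC⟩ := exists_quadratic_barrier hd ρ
  have hlast : ∀ x ∈ cap e Ω l \ {planeReflection e l 0}, -0 ≤ planeDiff e (V k) l x := by
    have := hV.planeDiff_add_nonneg hd hΩ hl le_rfl (ψ := fun _ => 0)
      (fun x => contDiffAt_const) (fun x _ => le_rfl) (fun x hx => ?_)
    · simpa using this
    · obtain ⟨h1, h2⟩ := hΩ.mem_diff_of_mem_cap hl hx
      rw [hV.laplacian_last _ h1, hV.laplacian_last _ h2, InnerProductSpace.laplacian_const]
      have h3 := h0 x hx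
      rw [planeDiff, sub_nonneg] at h3
      have := hf (hV.nonneg 0 (Nat.zero_le _) x) (hV.nonneg 0 (Nat.zero_le _) _) h3
      simpa using this
  have := hV.planeDiff_ge_of_last hd hΩ hl hC.le le_rfl hq hqΔ (fun x hx => hqC x (hρ hx)) hlast
    (i := k - j) (Nat.sub_le _ _) x hx
  rw [Nat.sub_sub_self hj] at this
  simpa using this

end IsCooperativeSolution

/-! ### Strict positivity of the differences. -/

namespace IsCooperativeSolution

theorem laplacian_planeDiff_zero_nonpos (hd : 2 ≤ Module.finrank ℝ E)
    (hf : MonotoneOn f (Ici 0)) (hV : IsCooperativeSolution k Ω f V) (hΩ : IsSteinerDomain e Ω)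
    (hl : 0 < l) (h0 : ∀ x ∈ cap e Ω l \ {planeReflection e l 0}, 0 ≤ planeDiff e (V 0) l x)
    {x : E} (hx : x ∈ cap e Ω l \ {planeReflection e l 0}) : Δ (planeDiff e (V 0) l) x ≤ 0 := by
  rw [(hV.laplacian_planeDiff hΩ hl (Nat.zero_le k) hx).2]
  obtain ⟨h1, h2⟩ := hΩ.mem_diff_of_mem_cap hl hx
  rcases Nat.eq_zero_or_pos k with rfl | hk
  · rw [hV.laplacian_last _ h1, hV.laplacian_last _ h2]
    have h3 := h0 x hx
    rw [planeDiff, sub_nonneg] at h3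
    have := hf (hV.nonneg 0 le_rfl x) (hV.nonneg 0 le_rfl _) h3
    linarith
  · rw [hV.laplacian_lt 0 hk _ h1, hV.laplacian_lt 0 hk _ h2]
    have := hV.planeDiff_nonneg_of_zero hd hf hΩ hl h0 (j := 0 + 1) hk x hx
    rw [planeDiff] at this
    linarith

/-- Moving from `x` in direction `e`, one leaves `Ω` at a point where `V 0` vanishes while its
reflection is still in `Ω`, so the difference is positive there and, by continuity, slightly before.
Being off the axis `ℝ e` keeps the segment away from the reflected origin and the reflected exit
point away from the origin. -/
theorem exists_planeDiff_pos (hV : IsCooperativeSolution k Ω f V) (hΩ : IsSteinerDomain e Ω)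
    (hl : 0 < l) {x : E} (hx : x ∈ cap e Ω l) (hxe : x ≠ (inner ℝ e x : ℝ) • e) :
    ∃ t : ℝ, 0 ≤ t ∧ (∀ s ∈ Icc 0 t, x + s • e ∈ cap e Ω l \ {planeReflection e l 0}) ∧
      0 < planeDiff e (V 0) l (x + t • e) := by
  have he := hΩ.norm_eq
  have hxl := hx.2
  have hinner : ∀ s : ℝ, inner ℝ e (x + s • e) = (inner ℝ e x : ℝ) + s := fun s => by
    rw [inner_add_right, inner_smul_right, real_inner_self_eq_norm_sq, he]
    ring
  set I : Set ℝ := {t | 0 ≤ t ∧ x + t • e ∈ Ω} with hI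
  have h0I : (0 : ℝ) ∈ I := ⟨le_rfl, by simpa using hx.1⟩
  have hmove : ∀ t ∈ I, ∀ s : ℝ, |(inner ℝ e x : ℝ) + s| ≤ inner ℝ e x + t → x + s • e ∈ Ω := by
    intro t ht s hs
    have h := hΩ.slide _ ht.2 (inner ℝ e x + s) (by
      rw [hinner]
      exact hs.trans (le_abs_self _))
    rw [hinner] at h
    convert h using 1
    module
  have hIbdd : BddAbove I := by
    obtain ⟨ρ, hρ⟩ := hΩ.isBounded.subset_closedBall 0
    refine ⟨ρ, fun t ht => ?_⟩
    have h1 : ‖x + t • e‖ ≤ ρ := by simpa using hρ ht.2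
    have h2 := real_inner_le_norm e (x + t • e)
    rw [hinner, he, one_mul] at h2
    linarith
  set a := sSup I with ha
  have ha0 : 0 ≤ a := le_csSup hIbdd h0I
  have hline : Continuous fun t : ℝ => x + t • e := by fun_prop
  have hya : x + a • e ∉ Ω := by
    intro hmem
    have h1 : ∀ᶠ t in 𝓝[>] a, x + t • e ∈ Ω :=
      (hline.continuousAt.eventually (hΩ.isOpen.mem_nhds hmem)).filter_mono nhdsWithin_le_nhds
    obtain ⟨t, ht, hat⟩ := (h1.and eventually_mem_nhdsWithin).exists
    have hat : a < t := hat
    exact hat.not_ge (le_csSup hIbdd ⟨ha0.trans hat.le, ht⟩)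
  have hrefl : planeReflection e l (x + a • e) = x + (2 * (l - inner ℝ e x) - a) • e := by
    rw [planeReflection, hinner]
    module
  have hyr : planeReflection e l (x + a • e) ∈ Ω := by
    obtain ⟨t, ht, hat⟩ := exists_lt_of_lt_csSup ⟨0, h0I⟩ (show a - l < sSup I by linarith)
    rw [hrefl]
    refine hmove t ht _ (abs_le.2 ⟨by linarith, by linarith [le_csSup hIbdd ht, ht.1]⟩)
  have hyr0 : planeReflection e l (x + a • e) ≠ 0 := by
    rw [hrefl]
    simpa using add_smul_ne_smul he hxe (2 * (l - inner ℝ e x) - a) 0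
  have hy0 : x + a • e ≠ 0 := by simpa using add_smul_ne_smul he hxe a 0
  have hpos : 0 < planeDiff e (V 0) l (x + a • e) := by
    rw [planeDiff, hV.eq_zero 0 (Nat.zero_le k) _ hya, sub_zero]
    exact hV.pos _ ⟨hyr, hyr0⟩
  have hcont : ContinuousAt (planeDiff e (V 0) l ∘ fun t : ℝ => x + t • e) a :=
    ContinuousAt.comp (hV.continuousAt_planeDiff (Nat.zero_le k) hy0 hyr0) hline.continuousAt
  obtain ⟨δ, hδ, hδpos⟩ := Metric.eventually_nhds_iff.1 (hcont.eventually (lt_mem_nhds hpos))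
  obtain ⟨t, ht, hat⟩ := exists_lt_of_lt_csSup ⟨0, h0I⟩ (show a - δ < sSup I by linarith)
  refine ⟨t, ht.1, fun s hs => ⟨⟨hmove t ht s ?_, ?_⟩, ?_⟩, hδpos ?_⟩
  · rw [abs_of_pos (by linarith [hs.1])]
    linarith [hs.2]
  · rw [hinner]
    linarith [hs.1]
  · rw [mem_singleton_iff, show planeReflection e l 0 = (2 * l) • e by simp [planeReflection]]
    exact add_smul_ne_smul he hxe s (2 * l)
  · rw [Real.dist_eq, abs_lt]
    constructor <;> linarith [le_csSup hIbdd ht]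

/-- The cap may be disconnected, so the strong maximum principle is applied along the segments of
`exists_planeDiff_pos`. Points on the axis are limits of off-axis points, and the positivity set is
relatively closed. -/
theorem planeDiff_pos (hd : 2 ≤ Module.finrank ℝ E)
    (hf : MonotoneOn f (Ici 0)) (hV : IsCooperativeSolution k Ω f V) (hΩ : IsSteinerDomain e Ω)
    (hl : 0 < l) (h0 : ∀ x ∈ cap e Ω l \ {planeReflection e l 0}, 0 ≤ planeDiff e (V 0) l x) :
    ∀ x ∈ cap e Ω l \ {planeReflection e l 0}, 0 < planeDiff e (V 0) l x := by
  have he := hΩ.norm_eq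
  set U := cap e Ω l \ {planeReflection e l 0} with hU
  have hUo : IsOpen U := (hΩ.isOpen_cap l).sdiff isClosed_singleton
  have hw : ∀ x ∈ U, ContDiffAt ℝ 2 (planeDiff e (V 0) l) x := fun x hx =>
    (hV.laplacian_planeDiff hΩ hl (Nat.zero_le k) hx).1
  have hΔ : ∀ x ∈ U, Δ (planeDiff e (V 0) l) x ≤ 0 := fun x hx =>
    hV.laplacian_planeDiff_zero_nonpos hd hf hΩ hl h0 hx
  have hoff : ∀ x ∈ cap e Ω l, x ≠ (inner ℝ e x : ℝ) • e → 0 < planeDiff e (V 0) l x := by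
    intro x hx hxe
    obtain ⟨t, ht, hseg, hpos⟩ := hV.exists_planeDiff_pos hΩ hl hx hxe
    have hS : IsPreconnected ((fun s : ℝ => x + s • e) '' Icc 0 t) :=
      isPreconnected_Icc.image _ (by fun_prop)
    refine pos_of_superharmonic hd hUo hw hΔ h0 hS ?_ ⟨t, ⟨ht, le_rfl⟩, rfl⟩ hpos x
      ⟨0, ⟨le_rfl, ht⟩, by simp⟩
    rintro _ ⟨s, hs, rfl⟩
    exact hseg s hs
  intro x hx
  by_cases hxe : x ≠ (inner ℝ e x : ℝ) • e
  · exact hoff x hx.1 hxe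
  rw [not_not] at hxe
  -- Dimension at least 2 supplies a direction in which to leave the axis.
  obtain ⟨v, hv, hv0⟩ : ∃ v : E, inner ℝ e v = 0 ∧ v ≠ 0 := by
    have h1 := Submodule.finrank_add_finrank_orthogonal (ℝ ∙ e)
    have h2 := finrank_span_singleton (K := ℝ) (v := e) (by rintro rfl; simp at he)
    have h3 : 0 < Module.finrank ℝ (ℝ ∙ e)ᗮ := by omega
    obtain ⟨v, hv⟩ := (Module.finrank_pos_iff_exists_ne_zero (R := ℝ)).1 h3
    exact ⟨v, Submodule.mem_orthogonal_singleton_iff_inner_right.1 v.2, by simpa using hv⟩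
  have hmem : x ∈ closure {y ∈ U | 0 < planeDiff e (V 0) l y} := by
    have hlim : Tendsto (fun s : ℝ => x + s • v) (𝓝[>] 0) (𝓝 x) := by
      have : Continuous fun s : ℝ => x + s • v := by fun_prop
      simpa using (this.tendsto 0).mono_left nhdsWithin_le_nhds
    refine mem_closure_of_tendsto hlim ?_
    filter_upwards [hlim.eventually (hUo.mem_nhds hx), eventually_mem_nhdsWithin] with s hs hs0
    refine ⟨hs, hoff _ hs.1 fun h => ?_⟩
    rw [inner_add_right, inner_smul_right, hv, mul_zero, add_zero, ← hxe] at h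
    have : s • v = 0 := by simpa using h
    rcases smul_eq_zero.1 this with h | h
    · exact (ne_of_gt hs0) h
    · exact hv0 h
  exact (closure_pos_inter_subset hd hUo hw hΔ h0 ⟨hmem, hx⟩).2

end IsCooperativeSolution

/-- When `l` drops below `l₀` the cap gains a strip that shrinks to the hyperplane, so `O` has to
contain the hyperplane. Compactness of `closure Ω \ O` makes the choice of `l` uniform. -/
theorem eventually_cap_diff_subset (hΩ : IsSteinerDomain e Ω)
    {l₀ : ℝ} {K O : Set E} (hO : IsOpen O) (h1 : cap e Ω l₀ \ K ⊆ O)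
    (h2 : {x | inner ℝ e x = l₀} ⊆ O) : ∀ᶠ l in 𝓝 l₀, cap e Ω l \ K ⊆ O := by
  have hC : IsCompact (closure Ω \ O) := hΩ.isBounded.isCompact_closure.diff hO
  have hci : Continuous fun q : ℝ × E => (inner ℝ e q.2 : ℝ) :=
    continuous_const.inner continuous_snd
  have h := hC.eventually_forall_of_forall_eventually (x₀ := l₀)
    (P := fun l x => x ∉ O → x ∉ cap e Ω l \ K) (fun x hx => ?_)
  · filter_upwards [h] with l hl x hx
    by_contra hxO
    exact hl x ⟨subset_closure hx.1.1, hxO⟩ hxO hx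
  · rcases lt_trichotomy (inner ℝ e x : ℝ) l₀ with h | h | h
    · filter_upwards [hci.continuousAt.eventually_lt continuous_fst.continuousAt h] with q hq _ hqc
      exact hq.not_gt hqc.1.2
    · exact absurd (h2 h) hx.2
    · filter_upwards [continuousAt_const.eventually_lt hci.continuousAt h] with q hq hqO hqc
      exact hqO (h1 ⟨⟨hqc.1.1, hq⟩, hqc.2⟩)

/-! ### Moving the hyperplane: openness and closedness of the set of good positions. -/

variable [MeasurableSpace E] [BorelSpace E]

theorem volume_inner_eq (he : e ≠ 0) (l : ℝ) :
    volume {x : E | inner ℝ e x = l} = 0 := by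
  set A : AffineSubspace ℝ E := AffineSubspace.mk' ((l / ‖e‖ ^ 2) • e) (ℝ ∙ e)ᗮ with hA
  have hn : ‖e‖ ^ 2 ≠ 0 := by simpa using he
  have hmem : ∀ x, x ∈ A ↔ inner ℝ e x = l := fun x => by
    rw [hA, AffineSubspace.mem_mk', Submodule.mem_orthogonal_singleton_iff_inner_right, vsub_eq_sub,
      inner_sub_right, inner_smul_right, real_inner_self_eq_norm_sq, div_mul_cancel₀ _ hn,
      sub_eq_zero]
  have htop : A ≠ ⊤ := fun h => by
    have h1 : ((l + 1) / ‖e‖ ^ 2) • e ∈ A := by rw [h]; trivial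
    rw [hmem, inner_smul_right, real_inner_self_eq_norm_sq, div_mul_cancel₀ _ hn] at h1
    linarith
  have := Measure.addHaar_affineSubspace volume A htop
  convert this using 2
  ext x
  exact (hmem x).symm

/-- A compact set that exhausts the cap at `l₀` up to small measure does so for the nearby caps. -/
theorem IsSteinerDomain.exists_isCompact_volume_cap_diff_lt (hΩ : IsSteinerDomain e Ω)
    (l₀ : ℝ) {δ : ENNReal} (hδ : 0 < δ) :
    ∃ K ⊆ cap e Ω l₀ \ {planeReflection e l₀ 0}, IsCompact K ∧
      ∀ᶠ l in 𝓝 l₀, volume (cap e Ω l \ K) < δ := by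
  set U := cap e Ω l₀ \ {planeReflection e l₀ 0} with hU
  have hUo : IsOpen U := (hΩ.isOpen_cap l₀).sdiff isClosed_singleton
  have hfin : volume U ≠ ⊤ :=
    (((hΩ.isBounded_cap l₀).subset sdiff_subset).measure_lt_top).ne
  obtain ⟨K, hKU, hK, hKδ⟩ := hUo.measurableSet.exists_isCompact_sdiff_lt hfin hδ.ne'
  have he : e ≠ 0 := by
    rintro rfl
    simpa using hΩ.norm_eq
  set N := (U \ K) ∪ ({planeReflection e l₀ 0} ∪ {x : E | inner ℝ e x = l₀}) with hN
  have hNδ : volume N < δ := by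
    have h0 : volume ({planeReflection e l₀ 0} ∪ {x : E | inner ℝ e x = l₀}) = 0 := by
      have : Nontrivial E := ⟨e, 0, he⟩
      rw [measure_union_null_iff]
      exact ⟨measure_singleton _, volume_inner_eq he l₀⟩
    refine (measure_union_le _ _).trans_lt ?_
    rwa [h0, add_zero]
  obtain ⟨O, hNO, hO, hOδ⟩ := N.exists_isOpen_lt_of_lt δ hNδ
  refine ⟨K, hKU, hK, ?_⟩
  have hsub : cap e Ω l₀ \ K ⊆ O := fun x hx => by
    by_cases hxp : x = planeReflection e l₀ 0
    · exact hNO (Or.inr (Or.inl hxp))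
    · exact hNO (Or.inl ⟨⟨hx.1, hxp⟩, hx.2⟩)
  filter_upwards [eventually_cap_diff_subset hΩ hO hsub fun x hx => hNO (Or.inr (Or.inr hx))]
    with l hl
  exact (measure_mono hl).trans_lt hOδ

namespace IsCooperativeSolution

/-- The nonnegativity of the differences is preserved when the hyperplane is moved slightly. -/
theorem eventually_planeDiff_nonneg (hd : 2 ≤ Module.finrank ℝ E)
    (hf : MonotoneOn f (Ici 0)) {L : ℝ≥0} (hL : LipschitzOnWith L f (Ici 0))
    (hV : IsCooperativeSolution k Ω f V) (hΩ : IsSteinerDomain e Ω)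
    {l₀ : ℝ} (hl₀ : 0 < l₀)
    (h0 : ∀ x ∈ cap e Ω l₀ \ {planeReflection e l₀ 0}, 0 ≤ planeDiff e (V 0) l₀ x) :
    ∀ᶠ l in 𝓝 l₀, ∀ x ∈ cap e Ω l \ {planeReflection e l 0}, 0 ≤ planeDiff e (V 0) l x := by
  have he := hΩ.norm_eq
  have : Nontrivial E := Module.nontrivial_of_finrank_pos (R := ℝ) (by omega)
  obtain ⟨ρ, hρ⟩ := hΩ.isBounded.closure.subset_ball 0
  obtain ⟨C, hC, q, hq, hqΔ, hqC⟩ := exists_quadratic_barrier hd ρ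
  have hL0 : (0 : ℝ) ≤ L := L.2
  -- Below, `ε` and `τ` are such that each of the two error terms, after the factor `C ^ k` from
  -- descending the system, costs at most `M / 4`.
  set ε : ℝ := 1 / (4 * (L * C ^ k + 1)) with hε
  have hε0 : 0 < ε := by positivity
  have hεL : L * ε * C ^ k ≤ 1 / 4 := by
    rw [hε, mul_one_div, div_mul_eq_mul_div, div_le_div_iff₀ (by positivity) (by norm_num)]
    linarith
  obtain ⟨δ, hδ, hpot⟩ := exists_small_potential hd (R := ρ) hε0
  obtain ⟨K, hKU, hK, hKδ⟩ := hΩ.exists_isCompact_volume_cap_diff_lt l₀ hδ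
  have hpos := hV.planeDiff_pos hd hf hΩ hl₀ h0
  have hKpos : ∀ᶠ l in 𝓝 l₀, ∀ x ∈ K, 0 < planeDiff e (V 0) l x := by
    refine hK.eventually_forall_of_forall_eventually fun x hx => ?_
    obtain ⟨h1, h2⟩ := hΩ.mem_diff_of_mem_cap hl₀ (hKU hx)
    exact (hV.continuousAt_planeDiff_prod (Nat.zero_le k) h1.2 h2.2).eventually
      (lt_mem_nhds (hpos x (hKU hx)))
  filter_upwards [hKδ, hKpos, lt_mem_nhds hl₀] with l hlδ hlK hl
  have hcl : ∀ x ∈ closure (cap e Ω l), x ∈ Metric.ball 0 ρ := fun x hx =>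
    hρ (closure_mono (fun y hy => hy.1) hx)
  have hstep : ∀ M > 0, (∀ x ∈ cap e Ω l \ {planeReflection e l 0}, -M ≤ planeDiff e (V 0) l x) →
      ∀ x ∈ cap e Ω l \ {planeReflection e l 0}, -(M / 2) ≤ planeDiff e (V 0) l x := by
    intro M hM hlow x hx
    set τ : ℝ := M / (4 * (L * C ^ (k + 1) + 1)) with hτ
    have hτ0 : 0 < τ := by positivity
    have hτL : L * τ * C ^ (k + 1) ≤ M / 4 := by
      rw [hτ, mul_div_assoc', div_mul_eq_mul_div, div_le_div_iff₀ (by positivity) (by norm_num)]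
      nlinarith
    -- The threshold `-τ` instead of `0`, together with the singular point, makes `D` closed and
    -- confines it, up to that point, to the part of the cap outside `K`.
    set D : Set E := {x ∈ closure (cap e Ω l) |
      x = planeReflection e l 0 ∨ planeDiff e (V 0) l x ≤ -τ} with hD
    have hcont := hV.continuousOn_planeDiff hΩ hl (Nat.zero_le k)
    have hDclosed : IsClosed D := by
      rw [← isOpen_compl_iff, isOpen_iff_mem_nhds]
      intro y hy
      by_cases hyc : y ∈ closure (cap e Ω l)
      · have hy' : ¬(y = planeReflection e l 0 ∨ planeDiff e (V 0) l y ≤ -τ) := fun h => hy ⟨hyc, h⟩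
        push Not at hy'
        have hc := hV.continuousAt_planeDiff (e := e) (l := l) (Nat.zero_le k)
          (ne_zero_of_inner_pos (hl.trans_le (inner_ge_of_mem_closure_cap hyc)))
          (planeReflection_ne_zero he hy'.1)
        filter_upwards [hc.eventually (lt_mem_nhds hy'.2),
          isOpen_compl_singleton.mem_nhds hy'.1] with z hz hzp hzD
        rcases hzD.2 with h | h
        · exact hzp h
        · linarith
      · filter_upwards [isClosed_closure.isOpen_compl.mem_nhds hyc] with z hz hzD
        exact hz hzD.1
    have hDcomp : IsCompact D :=
      (hΩ.isBounded_cap l).isCompact_closure.of_isClosed_subset hDclosed fun y hy => hy.1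
    have hDsub : D ⊆ (cap e Ω l \ K) ∪ {planeReflection e l 0} := by
      rintro y ⟨hyc, hy⟩
      rcases hy with hy | hy
      · exact Or.inr hy
      · left
        refine ⟨?_, fun hyK => ?_⟩
        · by_contra hyn
          have := hV.planeDiff_nonneg_of_mem_frontier hΩ (Nat.zero_le k)
            (show y ∈ frontier (cap e Ω l) from ⟨hyc, by rwa [(hΩ.isOpen_cap l).interior_eq]⟩)
          linarith
        · linarith [hlK y hyK]
    have hDδ : volume D < δ := by
      refine (measure_mono hDsub).trans_lt ((measure_union_le _ _).trans_lt ?_)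
      rwa [measure_singleton, add_zero]
    obtain ⟨φ, hφ, hφΔ, hφD, hφε⟩ := hpot D hDcomp (fun y hy => hcl y hy.1) hDδ
    -- By the Lipschitz bound, the defect of superharmonicity of the last difference is at most `L *
    -- M` on `D`, which `φ` compensates, and at most `L * τ` elsewhere, which `q` compensates.
    set ψ : E → ℝ := fun x => L * M * φ x + L * τ * q x with hψ
    have hφ' : ∀ x, ContDiffAt ℝ 2 (fun x => L * M * φ x) x := fun x => contDiffAt_const.mul (hφ x)
    have hψ2 : ∀ x, ContDiffAt ℝ 2 ψ x := fun x => (hφ' x).add (contDiffAt_const.mul (hq x))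
    have hψΔ : ∀ x, Δ ψ x = L * M * Δ φ x - L * τ := fun x => by
      have h3 : Δ (fun x => L * M * φ x) x = L * M * Δ φ x :=
        InnerProductSpace.laplacian_smul (L * M : ℝ) (hφ x)
      rw [hψ, laplacian_add_const_mul _ (hφ' x) (hq x), h3, hqΔ]
      ring
    have hψ0 : ∀ x ∈ closure (cap e Ω l), 0 ≤ ψ x := fun x hx => by
      have h1 := (hφε x (hcl x hx)).1
      have h2 := (hqC x (hcl x hx)).1
      positivity
    have hψA : ∀ x ∈ closure (cap e Ω l), ψ x ≤ L * M * ε + L * τ * C := fun x hx => by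
      have h1 := (hφε x (hcl x hx)).2
      have h2 := (hqC x (hcl x hx)).2
      simp only [hψ]
      gcongr
    have hlast := hV.planeDiff_add_nonneg hd hΩ hl le_rfl hψ2 hψ0 (fun x hx => by
      obtain ⟨h1, h2⟩ := hΩ.mem_diff_of_mem_cap hl hx
      rw [hV.laplacian_last _ h1, hV.laplacian_last _ h2, hψΔ]
      have ha := hV.nonneg 0 (Nat.zero_le k) x
      have hb := hV.nonneg 0 (Nat.zero_le k) (planeReflection e l x)
      have hLM : (0 : ℝ) ≤ L * M := by positivity
      have hLτ : (0 : ℝ) ≤ L * τ := by positivity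
      have h3 := mul_nonpos_of_nonneg_of_nonpos hLM (hφΔ x)
      rcases le_or_gt 0 (planeDiff e (V 0) l x) with hw | hw
      · rw [planeDiff, sub_nonneg] at hw
        linarith [hf ha hb hw]
      · have hlip : f (V 0 x) - f (V 0 (planeReflection e l x)) ≤ L * -planeDiff e (V 0) l x := by
          have := hL.dist_le_mul _ ha _ hb
          rw [Real.dist_eq, Real.dist_eq, abs_of_pos (a := V 0 x - _)
            (by rw [planeDiff] at hw; linarith)] at this
          rw [planeDiff, neg_sub]
          exact (le_abs_self _).trans this
        rcases le_or_gt (planeDiff e (V 0) l x) (-τ) with hwτ | hwτ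
        · have h4 := mul_le_mul_of_nonneg_left (hφD x ⟨subset_closure hx.1, Or.inr hwτ⟩) hLM
          have h5 := mul_le_mul_of_nonneg_left (neg_le.1 (hlow x hx)) hL0
          linarith
        · have h5 := mul_le_mul_of_nonneg_left (neg_lt.1 hwτ).le hL0
          linarith)
    have hfin := hV.planeDiff_ge_of_last hd hΩ hl hC.le
      (show 0 ≤ L * M * ε + L * τ * C by positivity) hq hqΔ (fun x hx => hqC x (hcl x hx))
      (fun x hx => by linarith [hlast x hx, hψA x (subset_closure hx.1)]) (le_refl k) x hx
    rw [Nat.sub_self] at hfin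
    have h6 : (L * M * ε + L * τ * C) * C ^ k = M * (L * ε * C ^ k) + L * τ * C ^ (k + 1) := by
      ring
    have h7 := mul_le_mul_of_nonneg_left hεL hM.le
    linarith
  obtain ⟨M, hM⟩ := hV.bddBelow_planeDiff hΩ hl (Nat.zero_le k)
  have hiter : ∀ i : ℕ, ∀ x ∈ cap e Ω l \ {planeReflection e l 0},
      -(max M 1 * (1 / 2) ^ i) ≤ planeDiff e (V 0) l x := by
    intro i
    induction i with
    | zero =>
      intro x hx
      have := hM x hx.1
      have := le_max_left M 1
      rw [pow_zero, mul_one]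
      linarith
    | succ i ih =>
      intro x hx
      have := hstep _ (by positivity) ih x hx
      rw [pow_succ]
      linarith
  intro x hx
  have hlim : Tendsto (fun i : ℕ => -(max M 1 * (1 / 2 : ℝ) ^ i)) atTop (𝓝 (-(max M 1 * 0))) :=
    ((tendsto_pow_atTop_nhds_zero_of_lt_one (by norm_num) (by norm_num)).const_mul _).neg
  simpa using le_of_tendsto hlim (Eventually.of_forall fun i => hiter i x hx)

theorem planeDiff_nonneg (hd : 2 ≤ Module.finrank ℝ E)
    (hf : MonotoneOn f (Ici 0)) {L : ℝ≥0} (hL : LipschitzOnWith L f (Ici 0))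
    (hV : IsCooperativeSolution k Ω f V) (hΩ : IsSteinerDomain e Ω) (hl : 0 < l) :
    ∀ x ∈ cap e Ω l \ {planeReflection e l 0}, 0 ≤ planeDiff e (V 0) l x := by
  have he := hΩ.norm_eq
  set G : Set ℝ := {l | 0 < l ∧
    ∀ x ∈ cap e Ω l \ {planeReflection e l 0}, 0 ≤ planeDiff e (V 0) l x} with hG
  have hGo : IsOpen G := isOpen_iff_mem_nhds.2 fun l₀ hl₀ =>
    (lt_mem_nhds hl₀.1).and (hV.eventually_planeDiff_nonneg hd hf hL hΩ hl₀.1 hl₀.2)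
  have hGne : (Ioi 0 ∩ G).Nonempty := by
    obtain ⟨ρ, hρ⟩ := hΩ.isBounded.subset_closedBall 0
    refine ⟨max ρ 1, by simp, by simp, fun x hx => ?_⟩
    exfalso
    have h1 : ‖x‖ ≤ ρ := by simpa using hρ hx.1.1
    have h2 := real_inner_le_norm e x
    rw [he, one_mul] at h2
    have h3 := hx.1.2
    have := le_max_left ρ 1
    linarith
  -- A negative value at `l₀` would persist for nearby `l`, with the same point still in the cap and
  -- off the singularity.
  have hGc : closure G ∩ Ioi 0 ⊆ G := by
    rintro l₀ ⟨hl₀c, hl₀⟩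
    have hl₀ : 0 < l₀ := hl₀
    refine ⟨hl₀, fun x hx => ?_⟩
    by_contra! hneg
    obtain ⟨h1, h2⟩ := hΩ.mem_diff_of_mem_cap hl₀ hx
    have hc : ContinuousAt (fun l => planeDiff e (V 0) l x) l₀ :=
      ContinuousAt.comp (f := fun l : ℝ => (l, x))
        (hV.continuousAt_planeDiff_prod (Nat.zero_le k) h1.2 h2.2) (by fun_prop)
    have hr : Continuous fun l => planeReflection e l 0 :=
      (continuous_planeReflection e).comp (by fun_prop : Continuous fun l : ℝ => (l, (0 : E)))
    have hev : ∀ᶠ l in 𝓝 l₀, planeDiff e (V 0) l x < 0 ∧ l < inner ℝ e x ∧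
        x ≠ planeReflection e l 0 :=
      (hc.eventually (gt_mem_nhds hneg)).and ((gt_mem_nhds hx.1.2).and
        ((hr.continuousAt.eventually_ne (Ne.symm hx.2)).mono fun _ h => h.symm))
    obtain ⟨l, hlG, h3, h4, h5⟩ := ((mem_closure_iff_frequently.1 hl₀c).and_eventually hev).exists
    exact h3.not_ge (hlG.2 x ⟨⟨hx.1.1, h4⟩, h5⟩)
  exact (isPreconnected_Ioi.subset_of_closure_inter_subset hGo hGne hGc hl).2

/-- Strict monotonicity in the direction `e`. -/
theorem lt_of_pos (hd : 2 ≤ Module.finrank ℝ E)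
    (hf : MonotoneOn f (Ici 0)) {L : ℝ≥0} (hL : LipschitzOnWith L f (Ici 0))
    (hV : IsCooperativeSolution k Ω f V) (hΩ : IsSteinerDomain e Ω) {x : E} {t : ℝ}
    (hx : 0 < (inner ℝ e x : ℝ)) (ht : 0 < t) (hy : x + t • e ∈ Ω) :
    V 0 (x + t • e) < V 0 x := by
  have he := hΩ.norm_eq
  have hinner : inner ℝ e (x + t • e) = (inner ℝ e x : ℝ) + t := by
    rw [inner_add_right, inner_smul_right, real_inner_self_eq_norm_sq, he]
    ring
  set l : ℝ := inner ℝ e x + t / 2 with hldef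
  have hl : 0 < l := by positivity
  have hrefl : planeReflection e l (x + t • e) = x := by
    rw [planeReflection, hinner, hldef]
    module
  have hmem : x + t • e ∈ cap e Ω l \ {planeReflection e l 0} := by
    refine ⟨⟨hy, by rw [hinner]; linarith⟩, fun h => ne_zero_of_inner_pos hx ?_⟩
    rw [← hrefl, mem_singleton_iff.1 h, planeReflection_planeReflection he]
  have := hV.planeDiff_pos hd hf hΩ hl (hV.planeDiff_nonneg hd hf hL hΩ hl) _ hmem
  rw [planeDiff, hrefl] at this
  linarith

/-- Limit of the inequality for `l > 0` as `l` tends to 0 with `x` fixed; neither `x` nor its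
reflection is the origin, so continuity applies. -/
theorem le_planeReflection (hd : 2 ≤ Module.finrank ℝ E)
    (hf : MonotoneOn f (Ici 0)) {L : ℝ≥0} (hL : LipschitzOnWith L f (Ici 0))
    (hV : IsCooperativeSolution k Ω f V) (hΩ : IsSteinerDomain e Ω) {x : E} (hxΩ : x ∈ Ω)
    (hx : 0 < (inner ℝ e x : ℝ)) : V 0 x ≤ V 0 (planeReflection e 0 x) := by
  have he := hΩ.norm_eq
  have hx0 := ne_zero_of_inner_pos hx
  have hp : ∀ l, planeReflection e l 0 = (2 * l) • e := fun l => by simp [planeReflection]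
  have hr0 : planeReflection e 0 x ≠ 0 := planeReflection_ne_zero he (by simpa [hp] using hx0)
  have hc : ContinuousAt (fun l => planeDiff e (V 0) l x) 0 :=
    ContinuousAt.comp (f := fun l : ℝ => (l, x))
      (hV.continuousAt_planeDiff_prod (Nat.zero_le k) hx0 hr0) (by fun_prop)
  have hr : Continuous fun l => planeReflection e l 0 :=
    (continuous_planeReflection e).comp (by fun_prop : Continuous fun l : ℝ => (l, (0 : E)))
  have hev : ∀ᶠ l in 𝓝[>] (0 : ℝ), 0 ≤ planeDiff e (V 0) l x := by
    have h1 : ∀ᶠ l in 𝓝 (0 : ℝ), l < inner ℝ e x ∧ planeReflection e l 0 ≠ x :=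
      (gt_mem_nhds hx).and (hr.continuousAt.eventually_ne (by simpa [hp] using hx0.symm))
    filter_upwards [h1.filter_mono nhdsWithin_le_nhds, eventually_mem_nhdsWithin] with l hl hl0
    exact hV.planeDiff_nonneg hd hf hL hΩ hl0 x ⟨⟨hxΩ, hl.1⟩, hl.2.symm⟩
  have := ge_of_tendsto (hc.tendsto.mono_left nhdsWithin_le_nhds) hev
  rwa [planeDiff, sub_nonneg] at this

/-- Symmetry with respect to the hyperplane orthogonal to `e`. -/
theorem planeReflection_eq (hd : 2 ≤ Module.finrank ℝ E)
    (hf : MonotoneOn f (Ici 0)) {L : ℝ≥0} (hL : LipschitzOnWith L f (Ici 0))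
    (hV : IsCooperativeSolution k Ω f V) (hΩ : IsSteinerDomain e Ω) {x : E} (hxΩ : x ∈ Ω) :
    V 0 (planeReflection e 0 x) = V 0 x := by
  have he := hΩ.norm_eq
  have hmem : ∀ y ∈ Ω, planeReflection e 0 y ∈ Ω := fun y hy => by
    have := hΩ.slide y hy (-inner ℝ e y) (by simp)
    convert this using 1
    rw [planeReflection]
    ring_nf
  have hneg : ∀ y, planeReflection (-e) 0 y = planeReflection e 0 y := fun y => by
    rw [planeReflection, planeReflection, inner_neg_left]
    module
  -- The reverse inequality is `le_planeReflection` for the direction `-e` at the reflected point.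
  have key : ∀ y ∈ Ω, 0 < (inner ℝ e y : ℝ) → V 0 (planeReflection e 0 y) = V 0 y := by
    intro y hy hpos
    refine le_antisymm ?_ (hV.le_planeReflection hd hf hL hΩ hy hpos)
    have := hV.le_planeReflection hd hf hL hΩ.neg (hmem y hy)
      (by rw [inner_neg_left, inner_planeReflection he]; linarith)
    rwa [hneg, planeReflection_planeReflection he] at this
  rcases lt_trichotomy (inner ℝ e x : ℝ) 0 with h | h | h
  · have := key _ (hmem x hxΩ) (by rw [inner_planeReflection he]; linarith)
    rw [planeReflection_planeReflection he] at this
    exact this.symm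
  · simp [planeReflection, h]
  · exact key x hxΩ h

end IsCooperativeSolution

end MovingPlanes

/-! ### From Navier solutions to cooperative systems, and the admissible directions. -/

section NavierSolutions

open Laplacian

theorem ContDiffOn.negLaplacian {n k : ℕ} {v : EuclideanSpace ℝ (Fin n) → ℝ}
    {U : Set (EuclideanSpace ℝ (Fin n))} (hU : IsOpen U)
    (hv : ContDiffOn ℝ ((k + 2 : ℕ) : WithTop ℕ∞) v U) :
    ContDiffOn ℝ (k : WithTop ℕ∞) (negLaplacian v) U := by
  have h1 : ContDiffOn ℝ ((k + 1 : ℕ) : WithTop ℕ∞) (fderiv ℝ v) U :=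
    hv.fderiv_of_isOpen hU (by norm_cast)
  have h2 : ContDiffOn ℝ (k : WithTop ℕ∞) (fderiv ℝ (fderiv ℝ v)) U :=
    h1.fderiv_of_isOpen hU (by norm_cast)
  have h3 : _root_.negLaplacian v = fun x => -∑ i, fderiv ℝ (fderiv ℝ v) x
      (EuclideanSpace.basisFun (Fin n) ℝ i) (EuclideanSpace.basisFun (Fin n) ℝ i) := by
    ext x
    rw [_root_.negLaplacian, laplacian_eq_sum_fderiv_fderiv (EuclideanSpace.basisFun (Fin n) ℝ)]
  rw [h3]
  exact (ContDiffOn.sum fun i _ =>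
    (h2.clm_apply contDiffOn_const).clm_apply contDiffOn_const).neg

theorem ContDiffOn.iterate_negLaplacian {n : ℕ} {v : EuclideanSpace ℝ (Fin n) → ℝ}
    {U : Set (EuclideanSpace ℝ (Fin n))} (hU : IsOpen U) (j : ℕ) {k : ℕ}
    (hv : ContDiffOn ℝ ((k + 2 * j : ℕ) : WithTop ℕ∞) v U) :
    ContDiffOn ℝ (k : WithTop ℕ∞) (_root_.negLaplacian^[j] v) U := by
  induction j generalizing k with
  | zero => simpa using hv
  | succ j ih =>
    rw [Function.iterate_succ_apply']
    refine ContDiffOn.negLaplacian hU (ih ?_)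
    convert hv using 2
    ring

variable {n k : ℕ} {Ω : Set (EuclideanSpace ℝ (Fin n))} {f : ℝ → ℝ}
  {u : EuclideanSpace ℝ (Fin n) → ℝ}

/-- The extension of `(-Δ)^j u` by zero from `Ω \ {0}`. -/
noncomputable def extendedPower (Ω : Set (EuclideanSpace ℝ (Fin n)))
    (u : EuclideanSpace ℝ (Fin n) → ℝ) (j : ℕ) : EuclideanSpace ℝ (Fin n) → ℝ :=
  (Ω \ {0}).indicator (negLaplacian^[j] u)

theorem extendedPower_of_mem {x : EuclideanSpace ℝ (Fin n)} (hx : x ∈ Ω \ {0}) (j : ℕ) :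
    extendedPower Ω u j x = negLaplacian^[j] u x :=
  indicator_of_mem hx _

theorem extendedPower_eventuallyEq (hΩ : IsOpen Ω) {x : EuclideanSpace ℝ (Fin n)}
    (hx : x ∈ Ω \ {0}) (j : ℕ) : extendedPower Ω u j =ᶠ[𝓝 x] negLaplacian^[j] u := by
  filter_upwards [(hΩ.sdiff isClosed_singleton).mem_nhds hx] with y hy
    using extendedPower_of_mem hy j

theorem laplacian_extendedPower (hΩ : IsOpen Ω) {x : EuclideanSpace ℝ (Fin n)}
    (hx : x ∈ Ω \ {0}) (j : ℕ) : Δ (extendedPower Ω u j) x = -negLaplacian^[j + 1] u x := by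
  rw [(InnerProductSpace.laplacian_congr_nhds (extendedPower_eventuallyEq hΩ hx j)).eq_of_nhds,
    Function.iterate_succ_apply', negLaplacian, neg_neg]

namespace IsPositiveNavierSolution

theorem contDiffAt_extendedPower (hΩ : IsOpen Ω) (hu : IsPositiveNavierSolution (k + 1) Ω f u)
    {j : ℕ} (hj : j ≤ k) {x : EuclideanSpace ℝ (Fin n)} (hx : x ∈ Ω \ {0}) :
    ContDiffAt ℝ 2 (extendedPower Ω u j) x := by
  have hU : IsOpen (Ω \ {0}) := hΩ.sdiff isClosed_singleton
  have h1 : ContDiffOn ℝ ((2 + 2 * j : ℕ) : WithTop ℕ∞) u (Ω \ {0}) :=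
    hu.contDiffOn.of_le (by norm_cast; omega)
  have h2 := (ContDiffOn.iterate_negLaplacian hU j h1).contDiffAt (hU.mem_nhds hx)
  exact h2.congr_of_eventuallyEq (extendedPower_eventuallyEq hΩ hx j)

/-- The Navier conditions are exactly what makes the extension by zero continuous across the
boundary. -/
theorem continuousAt_extendedPower (hΩ : IsOpen Ω) (hu : IsPositiveNavierSolution (k + 1) Ω f u)
    {j : ℕ} (hj : j ≤ k) {x : EuclideanSpace ℝ (Fin n)} (hx : x ≠ 0) :
    ContinuousAt (extendedPower Ω u j) x := by
  by_cases hxΩ : x ∈ Ω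
  · exact (hu.contDiffAt_extendedPower hΩ hj ⟨hxΩ, hx⟩).continuousAt
  have h0 : extendedPower Ω u j x = 0 := indicator_of_notMem (fun h => hxΩ h.1) _
  rw [ContinuousAt, h0]
  by_cases hxc : x ∈ closure Ω
  · have h := hu.navier j (by omega) x ⟨hxc, by rwa [hΩ.interior_eq]⟩
    intro N hN
    rw [mem_map]
    filter_upwards [mem_nhdsWithin_iff_eventually.1 (h hN)] with y hy
    by_cases hyΩ : y ∈ Ω \ {0}
    · rw [mem_preimage, extendedPower_of_mem hyΩ]
      exact hy hyΩ
    · rw [mem_preimage, extendedPower, indicator_of_notMem hyΩ]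
      exact mem_of_mem_nhds hN
  · refine tendsto_const_nhds.congr' ?_
    filter_upwards [isClosed_closure.isOpen_compl.mem_nhds hxc] with y hy
    exact (indicator_of_notMem (fun h => hy (subset_closure h.1)) _).symm

/-- Descending induction on the power, starting from `f u ≥ f 0 ≥ 0`: each power is superharmonic
with zero boundary values. The bound below at the singularity is assumed for positive powers and
follows from `u > 0` for the power 0. -/
theorem iterate_negLaplacian_nonneg (hn : 2 ≤ n) (hΩ : IsOpen Ω) (hb : Bornology.IsBounded Ω)
    (hf : IsAdmissibleNonlinearity f) (hu : IsPositiveNavierSolution (k + 1) Ω f u)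
    {i : ℕ} : i ≤ k → ∀ x ∈ Ω \ {0}, 0 ≤ negLaplacian^[k - i] u x := by
  have step : ∀ j ≤ k, (∀ x ∈ Ω \ {0}, 0 ≤ negLaplacian^[j + 1] u x) →
      ∀ x ∈ Ω \ {0}, 0 ≤ negLaplacian^[j] u x := by
    intro j hj h x hx
    rw [← extendedPower_of_mem hx]
    refine nonneg_of_superharmonic (by simpa using hn) hΩ hb 0
      (fun x hx => hu.contDiffAt_extendedPower hΩ hj hx) (fun x hx => ?_) ?_
      (fun x hx => (hu.continuousAt_extendedPower hΩ hj hx.2).continuousWithinAt)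
      (fun y hy _ => ?_) x hx
    · rw [laplacian_extendedPower hΩ hx]
      linarith [h x hx]
    · have hbelow : BddBelow (negLaplacian^[j] u '' (Ω \ {0})) := by
        rcases Nat.eq_zero_or_pos j with rfl | hj0
        · exact ⟨0, by rintro _ ⟨x, hx, rfl⟩; exact (hu.pos x hx).le⟩
        · exact hu.bddBelow j hj0 (by omega)
      rwa [image_congr fun x hx => extendedPower_of_mem hx j]
    · rw [frontier, hΩ.interior_eq] at hy
      exact (indicator_of_notMem (fun h => hy.2 h.1) _).ge
  induction i with
  | zero =>
    intro _
    refine step k le_rfl fun x hx => ?_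
    rw [hu.equation x hx]
    exact hf.zero_nonneg.trans (hf.monotone (mem_Ici.2 le_rfl) (hu.pos x hx).le (hu.pos x hx).le)
  | succ i ih =>
    intro hi
    refine step _ (Nat.sub_le _ _) ?_
    rw [show k - (i + 1) + 1 = k - i by omega]
    exact ih (by omega)

theorem isCooperativeSolution (hn : 2 ≤ n) (hΩ : IsOpen Ω) (hb : Bornology.IsBounded Ω)
    (hf : IsAdmissibleNonlinearity f) (hu : IsPositiveNavierSolution (k + 1) Ω f u) :
    IsCooperativeSolution k Ω f (extendedPower Ω u) where
  contDiffAt _ hj _ hx := hu.contDiffAt_extendedPower hΩ hj hx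
  continuousAt _ hj _ hx := hu.continuousAt_extendedPower hΩ hj hx
  eq_zero _ _ _ hx := indicator_of_notMem (fun h => hx h.1) _
  nonneg j hj x := by
    refine indicator_nonneg (fun y hy => ?_) x
    have := hu.iterate_negLaplacian_nonneg hn hΩ hb hf (Nat.sub_le k j) y hy
    rwa [Nat.sub_sub_self hj] at this
  pos x hx := by
    rw [extendedPower_of_mem hx]
    exact hu.pos x hx
  laplacian_lt j _ x hx := by rw [laplacian_extendedPower hΩ hx, extendedPower_of_mem hx]
  laplacian_last x hx := by
    rw [laplacian_extendedPower hΩ hx, extendedPower_of_mem hx, hu.equation x hx]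
    rfl

end IsPositiveNavierSolution

theorem isSteinerDomain_ball {E : Type*} [NormedAddCommGroup E] [InnerProductSpace ℝ E] {e : E}
    (he : ‖e‖ = 1) (R : ℝ) : IsSteinerDomain e (Metric.ball 0 R) where
  norm_eq := he
  isOpen := Metric.isOpen_ball
  isBounded := Metric.isBounded_ball
  slide x hx t ht := by
    rw [mem_ball_zero_iff] at hx ⊢
    refine lt_of_le_of_lt ?_ hx
    rw [← sq_le_sq₀ (norm_nonneg _) (norm_nonneg _), norm_add_sq_real, inner_smul_right, norm_smul,
      mul_pow, he, Real.norm_eq_abs, sq_abs, real_inner_comm]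
    have := sq_le_sq.2 ht
    rw [real_inner_comm] at this
    nlinarith

theorem inner_single_one {n : ℕ} (i : Fin n) (x : EuclideanSpace ℝ (Fin n)) :
    inner ℝ (EuclideanSpace.single i (1 : ℝ)) x = x i := by
  simp [EuclideanSpace.inner_single_left]

theorem planeReflection_single {n : ℕ} (i : Fin n) (x : EuclideanSpace ℝ (Fin n)) :
    planeReflection (EuclideanSpace.single i (1 : ℝ)) 0 x = coordReflection i x := by
  ext j
  rw [planeReflection, inner_single_one, coordReflection]
  by_cases h : j = i
  · subst h
    simp
    ring
  · simp [h]

theorem IsSymmetricConvexDomain.isSteinerDomain {n : ℕ} {i : Fin n}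
    {Ω : Set (EuclideanSpace ℝ (Fin n))} (hΩ : IsSymmetricConvexDomain i Ω) :
    IsSteinerDomain (EuclideanSpace.single i (1 : ℝ)) Ω where
  norm_eq := by simp
  isOpen := hΩ.isOpen
  isBounded := hΩ.isBounded
  slide x hx t ht := by
    rw [inner_single_one] at ht ⊢
    rcases eq_or_ne (x i) 0 with h0 | h0
    · rw [h0, abs_zero, abs_nonpos_iff] at ht
      simpa [h0, ht] using hx
    · have habs : |t / x i| ≤ 1 := by
        rw [abs_div]
        exact div_le_one_of_le₀ ht (abs_nonneg _)
      -- The point with `i`-th coordinate `t` is the convex combination of `x` and its mirror image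
      -- with weight `(1 - t / x i) / 2` on the latter.
      have h := hΩ.convex_dir x hx _ (hΩ.reflection_mem x hx)
        (fun j hj => by simp [coordReflection, hj]) ((1 - t / x i) / 2)
        ⟨by linarith [(abs_le.1 habs).2], by linarith [(abs_le.1 habs).1]⟩
      convert h using 1
      rw [← planeReflection_single, planeReflection, inner_single_one]
      have : t - x i = (1 - t / x i) / 2 * (2 * (0 - x i)) := by
        field_simp
        ring
      rw [this]
      module

/-- The reflection in the bisecting hyperplane exchanges two vectors of the same norm. -/
theorem planeReflection_bisector {E : Type*} [NormedAddCommGroup E] [InnerProductSpace ℝ E]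
    {x y : E} (hxy : ‖x‖ = ‖y‖) (hne : x ≠ y) :
    planeReflection (‖x - y‖⁻¹ • (x - y)) 0 x = y := by
  have h0 : ‖x - y‖ ≠ 0 := norm_ne_zero_iff.2 (sub_ne_zero.2 hne)
  have h1 : 2 * (inner ℝ (x - y) x : ℝ) = ‖x - y‖ ^ 2 := by
    rw [norm_sub_sq_real, inner_sub_left, real_inner_self_eq_norm_sq, ← hxy, real_inner_comm]
    ring
  have h2 : 2 * (0 - ‖x - y‖⁻¹ * (inner ℝ (x - y) x : ℝ)) * ‖x - y‖⁻¹ = -1 := by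
    field_simp
    linarith
  rw [planeReflection, real_inner_smul_left, smul_smul, h2]
  module

end NavierSolutions

/-! ### The symmetry theorem. -/

theorem theorem1p1 {n m : ℕ} (hn : 2 ≤ n) (hm : 1 ≤ m)
    (Ω : Set (EuclideanSpace ℝ (Fin n)))
    (hΩ : IsSymmetricConvexDomain (⟨0, by omega⟩ : Fin n) Ω)
    (f : ℝ → ℝ) (hf : IsAdmissibleNonlinearity f)
    (u : EuclideanSpace ℝ (Fin n) → ℝ) (hu : IsPositiveNavierSolution m Ω f u) :
    -- symmetry in the first coordinate
    (∀ x ∈ Ω \ {0}, u (coordReflection ⟨0, by omega⟩ x) = u x) ∧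
    -- strict decrease in the first coordinate where it is positive
    (∀ x ∈ Ω, ∀ y ∈ Ω, (∀ j : Fin n, j ≠ ⟨0, by omega⟩ → x j = y j) →
      0 < x ⟨0, by omega⟩ → x ⟨0, by omega⟩ < y ⟨0, by omega⟩ → u y < u x) ∧
    -- on a ball centred at the origin: radial and strictly radially decreasing
    (∀ R : ℝ, 0 < R → Ω = Metric.ball 0 R →
      ∃ φ : ℝ → ℝ, (∀ x ∈ Ω \ {0}, u x = φ ‖x‖) ∧ StrictAntiOn φ (Ioo 0 R)) := by
  obtain ⟨k, rfl⟩ : ∃ k, m = k + 1 := ⟨m - 1, by omega⟩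
  obtain ⟨L, hL⟩ := hf.lipschitz
  have hd : 2 ≤ Module.finrank ℝ (EuclideanSpace ℝ (Fin n)) := by simpa using hn
  have hV := hu.isCooperativeSolution hn hΩ.isOpen hΩ.isBounded hf
  have hVu : ∀ x ∈ Ω \ {0}, extendedPower Ω u 0 x = u x := fun x hx => extendedPower_of_mem hx 0
  set i : Fin n := ⟨0, by omega⟩ with hi
  set e : EuclideanSpace ℝ (Fin n) := EuclideanSpace.single i 1 with he
  have he1 : ‖e‖ = 1 := by simp [he]
  have hinner : ∀ x, inner ℝ e x = x i := inner_single_one i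
  have hS := hΩ.isSteinerDomain
  refine ⟨fun x hx => ?_, fun x hx y hy hxy hx0 hlt => ?_, fun R hR hball => ?_⟩
  · have hne : coordReflection i x ≠ 0 := by
      rw [← planeReflection_single]
      exact planeReflection_ne_zero he1 (by simpa [planeReflection] using hx.2)
    have h := hV.planeReflection_eq hd hf.monotone hL hS hx.1
    rwa [planeReflection_single, hVu x hx, hVu _ ⟨hΩ.reflection_mem x hx.1, hne⟩] at h
  · have hyx : y = x + (y i - x i) • e := by
      ext j
      by_cases hj : j = i
      · subst hj
        simp [he]
      · simp [he, hj, hxy j hj]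
    have hx' : x ∈ Ω \ {0} := ⟨hx, ne_zero_of_inner_pos (e := e) (by rwa [hinner])⟩
    have hy' : y ∈ Ω \ {0} :=
      ⟨hy, ne_zero_of_inner_pos (e := e) (by rw [hinner]; exact hx0.trans hlt)⟩
    have h := hV.lt_of_pos hd hf.monotone hL hS (x := x) (t := y i - x i) (by rwa [hinner])
      (sub_pos.2 hlt) (by rwa [← hyx])
    rwa [← hyx, hVu x hx', hVu y hy'] at h
  -- The profile is read off along the ray through `e`. A point `x` off that ray is sent to `‖x‖ •
  -- e` by reflection in the bisecting hyperplane, whose normal is an admissible direction for the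
  -- ball.
  · refine ⟨fun r => extendedPower Ω u 0 (r • e), fun x hx => ?_, fun r hr s hs hrs => ?_⟩
    · rw [← hVu x hx]
      rcases eq_or_ne x (‖x‖ • e) with h | h
      · exact congrArg (extendedPower Ω u 0) h
      · have hnorm : ‖x‖ = ‖‖x‖ • e‖ := by rw [norm_smul, he1, norm_norm, mul_one]
        have hb : IsSteinerDomain (‖x - ‖x‖ • e‖⁻¹ • (x - ‖x‖ • e)) Ω := by
          rw [hball]
          refine isSteinerDomain_ball ?_ R
          rw [norm_smul, norm_inv, norm_norm, inv_mul_cancel₀]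
          exact norm_ne_zero_iff.2 (sub_ne_zero.2 h)
        have := hV.planeReflection_eq hd hf.monotone hL hb hx.1
        rwa [planeReflection_bisector hnorm h, eq_comm] at this
    · have hinner_r : inner ℝ e (r • e) = r := by
        rw [inner_smul_right, real_inner_self_eq_norm_sq, he1]
        ring
      have hsum : r • e + (s - r) • e = s • e := by module
      have h := hV.lt_of_pos hd hf.monotone hL hS (x := r • e) (t := s - r)
        (by rw [hinner_r]; exact hr.1) (sub_pos.2 hrs)
        (by rw [hsum, hball, mem_ball_zero_iff, norm_smul, he1, mul_one, Real.norm_eq_abs,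
          abs_of_pos hs.1]; exact hs.2)
      rwa [hsum] at h
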